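/- A frame $\mathfrak F=\langle W,R\rangle$ is a non-empty set $W$ with a binary relation $R$ on it. It is a \emph{weak order} if $R$ is transitive and weakly connected, i.e. $\forall x,y,z\,(xRy\wedge xRz\to(y=z\vee yRz\vee zRy))$. It \emph{contains an $\langle\omega+1,>\rangle$-type chain} if there are distinct points $x_n\in W$ ($n\le\omega$) such that, for all $n,m\le\omega$ with $n\ne m$, $x_nRx_m$ iff $n>m$; nothing is required about $x_nRx_n$, so $\mathfrak F$ may be reflexive and/or dense. Let $\mathcal C_{\mathrm{diff}}$ be the class of all difference frames $\langle W,\ne\rangle$. A frame $\langle W,R\rangle$ is a \emph{subframe} of $\langle U,S\rangle$ if $W\subseteq U$ and $R=S\cap(W\times W)$. For classes $\mathcal C_0,\mathcal C_1$ of frames, $\mathcal C_0\times^{d}\mathcal C_1$ is the class of all 2-frames of the following form: for some $\langle W,R\rangle\in\mathcal C_0$ and some frames $\mathfrak G_u=\langle W_u,R_u\rangle\in\mathcal C_1$ ($u\in W$) such that $\mathfrak G_y$ is a subframe of $\mathfrak G_x$ whenever $xRy$, the points are the pairs $\langle u,v\rangle$ with $u\in W$, $v\in W_u$; $\langle u,v\rangle$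 is $0$-related to $\langle u',v'\rangle$ iff $uRu'$ and $v=v'$; and it is $1$-related to $\langle u',v'\rangle$ iff $u=u'$ and $vR_uv'$. Bimodal formulas are built from countably many propositional variables by $\neg,\wedge,\Diamond_0,\Diamond_1$, with the usual Kripke semantics; for a class $\mathcal K$ of 2-frames, $\mathcal K$-satisfiability is the problem whether a given bimodal formula is true at some point of some model based on some member of $\mathcal K$. Theorem. Let $\mathcal C$ be any class of weak orders such that some $\mathfrak F\in\mathcal C$ contains an $\langle\omega+1,>\rangle$-type chain. Then $\mathcal C\times^{d}\mathcal C_{\mathrm{diff}}$-satisfiability is undecidable. Moreover, consider one-variable first-order temporal formulas built from countably many monadic atoms $P(x)$ by $\neg,\wedge,\Diamond_F$ and $\exists^{\ne}x$ (FOLTL$^{\ne}$). A model over a linear order $\langle T,<\rangle$ has a non-empty domain $D_t$ and interpretations $P^{(t)}\subseteq D_t$ for every $t\in T$; formulas are evaluated at $t\in T$ and $a\in D_t$, where $P(x)$ holds iff $a\in P^{(t)}$, $\Diamond_F\varphi$ holds iff $\varphi$ holds at some $t'>t$ with $a\in D_{t'}$ (and the same $a$), and $\exists^{\ne}x\,\varphi$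 holds iff $\varphi$ holds at $t$ and some $b\in D_t$ with $b\ne a$. The model has constant (decreasing) domains if $D_t=D_{t'}$ ($D_t\supseteq D_{t'}$) whenever $t<t'$. Then FOLTL$^{\ne}$-satisfiability is undecidable both in constant and in decreasing domain models, over $\langle\mathbb Q,<\rangle$ and over $\langle\mathbb R,<\rangle$. -/

import Mathlib

universe u v

/-! ### Bimodal formulas and their effective numbering -/

/-- Bimodal formulas over the propositional variables `var 0, var 1, …`. -/
inductive BiFormula : Type
  | var (p : ℕ) : BiFormula
  | neg (φ : BiFormula) : BiFormula
  | and (φ ψ : BiFormula) : BiFormula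
  | dia0 (φ : BiFormula) : BiFormula
  | dia1 (φ : BiFormula) : BiFormula

namespace BiFormula

/-- The Gödel number of a bimodal formula. -/
def toNat : BiFormula → ℕ
  | var p => 5 * p
  | neg φ => 5 * toNat φ + 1
  | and φ ψ => 5 * Nat.pair (toNat φ) (toNat ψ) + 2
  | dia0 φ => 5 * toNat φ + 3
  | dia1 φ => 5 * toNat φ + 4

/-- The formula with a given Gödel number; every natural number is a Gödel number. -/
def ofNat (n : ℕ) : BiFormula :=
  if n % 5 = 0 then var (n / 5)
  else if _h : n = 0 then var 0
  else if n % 5 = 1 then neg (ofNat (n / 5))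
  else if n % 5 = 2 then and (ofNat (n / 5).unpair.1) (ofNat (n / 5).unpair.2)
  else if n % 5 = 3 then dia0 (ofNat (n / 5))
  else dia1 (ofNat (n / 5))
termination_by n
decreasing_by
  · omega
  · have := Nat.unpair_left_le (n / 5); omega
  · have := Nat.unpair_right_le (n / 5); omega
  · omega
  · omega

theorem ofNat_toNat (φ : BiFormula) : ofNat (toNat φ) = φ := by
  induction φ with
  | var p =>
    rw [toNat, ofNat, if_pos (by omega), show 5 * p / 5 = p by omega]
  | neg φ ih =>
    rw [toNat, ofNat, if_neg (by omega), dif_neg (by omega), if_pos (by omega),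
      show (5 * toNat φ + 1) / 5 = toNat φ by omega, ih]
  | and φ ψ ih1 ih2 =>
    rw [toNat, ofNat, if_neg (by omega), dif_neg (by omega), if_neg (by omega),
      if_pos (by omega), show (5 * Nat.pair (toNat φ) (toNat ψ) + 2) / 5
        = Nat.pair (toNat φ) (toNat ψ) by omega, Nat.unpair_pair, ih1, ih2]
  | dia0 φ ih =>
    rw [toNat, ofNat, if_neg (by omega), dif_neg (by omega), if_neg (by omega),
      if_neg (by omega), if_pos (by omega),
      show (5 * toNat φ + 3) / 5 = toNat φ by omega, ih]
  | dia1 φ ih =>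
    rw [toNat, ofNat, if_neg (by omega), dif_neg (by omega), if_neg (by omega),
      if_neg (by omega), if_neg (by omega),
      show (5 * toNat φ + 4) / 5 = toNat φ by omega, ih]

theorem toNat_ofNat (n : ℕ) : toNat (ofNat n) = n := by
  induction n using Nat.strong_induction_on with
  | _ n ih =>
    rw [ofNat]
    split_ifs with h0 h h1 h2 h3
    · rw [toNat]; omega
    · exact absurd h (by omega)
    · rw [toNat, ih _ (by omega)]; omega
    · have a := Nat.unpair_left_le (n / 5)
      have b := Nat.unpair_right_le (n / 5)
      rw [toNat, ih _ (by omega), ih _ (by omega), Nat.pair_unpair]; omega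
    · rw [toNat, ih _ (by omega)]; omega
    · rw [toNat, ih _ (by omega)]; omega

/-- The Gödel numbering, as a bijection between formulas and natural numbers. -/
def equivNat : BiFormula ≃ ℕ where
  toFun := toNat
  invFun := ofNat
  left_inv := ofNat_toNat
  right_inv := toNat_ofNat

/-- Computability of problems about bimodal formulas refers to the Gödel numbering. -/
instance : Primcodable BiFormula := Primcodable.ofEquiv ℕ equivNat

end BiFormula

/-! ### Frames, models, satisfiability -/

/-- A (unimodal) frame `⟨W, R⟩`. -/
structure KripkeFrame where
  W : Type u
  nonempty : Nonempty W
  R : W → W → Prop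

/-- A 2-frame `⟨W, R₀, R₁⟩`. -/
structure TwoFrame where
  W : Type u
  nonempty : Nonempty W
  R0 : W → W → Prop
  R1 : W → W → Prop

/-- `H.Truth ν w φ`: the formula `φ` is true at `w` in the model `(H, ν)`. -/
def TwoFrame.Truth (H : TwoFrame.{u}) (ν : ℕ → Set H.W) : H.W → BiFormula → Prop
  | w, .var p => w ∈ ν p
  | w, .neg φ => ¬ H.Truth ν w φ
  | w, .and φ ψ => H.Truth ν w φ ∧ H.Truth ν w ψ
  | w, .dia0 φ => ∃ v, H.R0 w v ∧ H.Truth ν v φ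
  | w, .dia1 φ => ∃ v, H.R1 w v ∧ H.Truth ν v φ

/-- `φ` is satisfied in a model based on some 2-frame of the class `K`. -/
def IsSatisfiableIn (K : Set TwoFrame.{u}) (φ : BiFormula) : Prop :=
  ∃ H ∈ K, ∃ (ν : ℕ → Set H.W) (w : H.W), H.Truth ν w φ

/-- A weak order: a transitive and weakly connected relation. -/
def KripkeFrame.IsWeakOrder (F : KripkeFrame.{u}) : Prop :=
  (∀ x y z, F.R x y → F.R y z → F.R x z) ∧
  (∀ x y z, F.R x y → F.R x z → y = z ∨ F.R y z ∨ F.R z y)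

/-- `F` contains an `⟨ω + 1, >⟩`-type chain: distinct points `x n`, for `n ≤ ω`, with
`x n R x m ↔ n > m` whenever `n ≠ m`. Nothing is required of `x n R x n`. -/
def KripkeFrame.ContainsOmegaSuccChain (F : KripkeFrame.{u}) : Prop :=
  ∃ x : ℕ∞ → F.W, Function.Injective x ∧
    ∀ n m : ℕ∞, n ≠ m → (F.R (x n) (x m) ↔ n > m)

/-- The class of all difference frames `⟨W, ≠⟩`. -/
def diffFrames : Set KripkeFrame.{u} :=
  {F | ∀ x y, F.R x y ↔ x ≠ y}

/-! ### Decreasing 2-frames -/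

/-- A frame whose set of points is a subset of a given type `V`. -/
structure FrameIn (V : Type u) where
  carrier : Set V
  nonempty : carrier.Nonempty
  R : V → V → Prop
  mem_of_R : ∀ a b, R a b → a ∈ carrier ∧ b ∈ carrier

/-- A frame with points in `V`, regarded as a frame. -/
def FrameIn.toFrame {V : Type u} (G : FrameIn V) : KripkeFrame.{u} where
  W := G.carrier
  nonempty := G.nonempty.to_subtype
  R a b := G.R a b

/-- `⟨W, R⟩` is a subframe of `⟨U, S⟩`: `W ⊆ U` and `R = S ∩ (W × W)`. -/
def FrameIn.IsSubframe {V : Type u} (G G' : FrameIn V) : Prop :=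
  G.carrier ⊆ G'.carrier ∧
    ∀ a b, G.R a b ↔ G'.R a b ∧ a ∈ G.carrier ∧ b ∈ G.carrier

/-- The 2-frame with horizontal frame `F` and vertical frame `G u` at each `u` in `F`: its
points are the pairs `⟨u, v⟩` with `u` in `F` and `v` in `G u`. -/
def twoDimFrame (F : KripkeFrame.{u}) {V : Type v} (G : F.W → FrameIn V) :
    TwoFrame.{max u v} where
  W := {p : F.W × V // p.2 ∈ (G p.1).carrier}
  nonempty := by
    obtain ⟨x⟩ := F.nonempty
    obtain ⟨y, hy⟩ := (G x).nonempty
    exact ⟨⟨(x, y), hy⟩⟩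
  R0 p q := F.R p.1.1 q.1.1 ∧ p.1.2 = q.1.2
  R1 p q := (G p.1.1).R p.1.2 q.1.2 ∧ p.1.1 = q.1.1

/-- The class of all decreasing 2-frames with horizontal frame in `C₀` and all vertical frames
in `C₁`. -/
def decreasingProduct (C₀ : Set KripkeFrame.{u}) (C₁ : Set KripkeFrame.{v}) :
    Set TwoFrame.{max u v} :=
  {H | ∃ F ∈ C₀, ∃ (V : Type v) (G : F.W → FrameIn V),
    (∀ x, (G x).toFrame ∈ C₁) ∧
    (∀ x y, F.R x y → (G y).IsSubframe (G x)) ∧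
    H = twoDimFrame F G}

/-! ### One-variable first-order linear temporal logic with counting to two -/

/-- The formulas `P(x)`, `¬φ`, `φ ∧ ψ`, `◇_F φ`, `∃^≠ x φ`, over the monadic predicate symbols
`0, 1, …`. -/
inductive FOLTLFormula : Type
  | pred (p : ℕ) : FOLTLFormula
  | neg (φ : FOLTLFormula) : FOLTLFormula
  | and (φ ψ : FOLTLFormula) : FOLTLFormula
  | diaF (φ : FOLTLFormula) : FOLTLFormula
  | existsNe (φ : FOLTLFormula) : FOLTLFormula

namespace FOLTLFormula

/-- The notational translation to bimodal formulas. -/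
def toBi : FOLTLFormula → BiFormula
  | pred p => .var p
  | neg φ => .neg (toBi φ)
  | and φ ψ => .and (toBi φ) (toBi ψ)
  | diaF φ => .dia0 (toBi φ)
  | existsNe φ => .dia1 (toBi φ)

/-- The inverse of the notational translation. -/
def ofBi : BiFormula → FOLTLFormula
  | .var p => pred p
  | .neg φ => neg (ofBi φ)
  | .and φ ψ => and (ofBi φ) (ofBi ψ)
  | .dia0 φ => diaF (ofBi φ)
  | .dia1 φ => existsNe (ofBi φ)

/-- The notational translation is a bijection. -/
def equivBi : FOLTLFormula ≃ BiFormula where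
  toFun := toBi
  invFun := ofBi
  left_inv φ := by induction φ <;> simp_all [toBi, ofBi]
  right_inv φ := by induction φ <;> simp_all [toBi, ofBi]

/-- Formulas are numbered through their notational translation. -/
instance : Primcodable FOLTLFormula := Primcodable.ofEquiv BiFormula equivBi

end FOLTLFormula

/-- A model based on the linear order `⟨T, <⟩`, whose domains are subsets of the type `U`. -/
structure FOLTLModel (T : Type u) [LinearOrder T] (U : Type v) where
  dom : T → Set U
  dom_nonempty : ∀ t, (dom t).Nonempty
  interp : (t : T) → ℕ → Set (dom t)

namespace FOLTLModel

variable {T : Type u} [LinearOrder T] {U : Type v}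

/-- `M.Truth t a φ`: the formula `φ` is true at the moment `t` under the assignment `x ↦ a`. -/
def Truth (M : FOLTLModel T U) : (t : T) → M.dom t → FOLTLFormula → Prop
  | t, a, .pred p => a ∈ M.interp t p
  | t, a, .neg φ => ¬ M.Truth t a φ
  | t, a, .and φ ψ => M.Truth t a φ ∧ M.Truth t a ψ
  | t, a, .diaF φ => ∃ t', t < t' ∧ ∃ h : (a : U) ∈ M.dom t', M.Truth t' ⟨a, h⟩ φ
  | t, a, .existsNe φ => ∃ b : M.dom t, b ≠ a ∧ M.Truth t b φ

def IsConstantDomain (M : FOLTLModel T U) : Prop :=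
  ∀ t t', t < t' → M.dom t = M.dom t'

def IsDecreasingDomain (M : FOLTLModel T U) : Prop :=
  ∀ t t', t < t' → M.dom t' ⊆ M.dom t

def IsSatisfiable (M : FOLTLModel T U) (φ : FOLTLFormula) : Prop :=
  ∃ (t : T) (a : M.dom t), M.Truth t a φ

end FOLTLModel

/-- Satisfiability in constant domain models over `⟨T, <⟩`. -/
def FOLTLSatConstant (T : Type u) [LinearOrder T] (φ : FOLTLFormula) : Prop :=
  ∃ (U : Type v) (M : FOLTLModel T U), M.IsConstantDomain ∧ M.IsSatisfiable φ

/-- Satisfiability in decreasing domain models over `⟨T, <⟩`. -/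
def FOLTLSatDecreasing (T : Type u) [LinearOrder T] (φ : FOLTLFormula) : Prop :=
  ∃ (U : Type v) (M : FOLTLModel T U), M.IsDecreasingDomain ∧ M.IsSatisfiable φ

/-! ### Counter machines as transition tables -/

/-! Non-termination of counter machines is reduced to satisfiability. A search for a zero of a
primitive recursive function gives one machine whose set of inputs with an infinite run is
undecidable (`exists_undecidable_hasRun`), and `runF` turns an input into a formula that is
satisfiable iff the run on it is infinite.

A run is laid out against the accessibility relation: step m takes place at a point x_m with x_{m+1}
R x_m, and a root sees all these points. This is what an ω + 1 chain provides. Hence ◇₀ looks into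
the past of the run. At step m a current element records the transition, and a different element is
marked as the current one of step m + 1. A formula at the root requires every marked element to be
current somewhere, and the rules force this to happen R-before the mark. So every step has a
successor, although nothing at x_m can look ahead (`GridModel.Ruled.exists_ticks`).

The frame may be reflexive or dense, so ◇₀ alone does not separate the steps. They are ticks of two
alternating colours, and `laterF` replaces the strict diamond by passing through a tick of the other
colour. A run of equally coloured points acts as a single step: letters and events agree on it
(`GridModel.Ruled.letter_of_sameRun`, `GridModel.Ruled.event_of_sameRun`).

A counter is the set of elements added in the past and not yet removed. The difference operator
makes the event of a transition happen to exactly one element. An added element was not removed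
before, and a removed one was added before, so each set changes by exactly one element
(`GridModel.Ruled.counterSet_step`). Columns shrink along R, hence grow along the run, and no
counter element is lost. So every model yields a run (`GridModel.hasRun_of_holds`). Conversely, a
run yields a model with constant columns in which all variables are false off the chain
(`GridModel.holds_ofRun`). Constant domains being decreasing, one formula settles both cases. -/

/-- The elementary actions of a counter machine. -/
inductive CounterOp : Type
  | inc (r : ℕ) : CounterOp
  | dec (r : ℕ) : CounterOp
  | zero (r : ℕ) : CounterOp

namespace CounterOp

/-- The register an action is about. -/
def reg : CounterOp → ℕ
  | inc r => r
  | dec r => r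
  | zero r => r

/-- The effect of an action on the registers. -/
def Rel : CounterOp → (ℕ → ℕ) → (ℕ → ℕ) → Prop
  | inc r, s, s' => s' = Function.update s r (s r + 1)
  | dec r, s, s' => s r ≠ 0 ∧ s' = Function.update s r (s r - 1)
  | zero r, s, s' => s r = 0 ∧ s' = s

/-- A numbering of the actions. -/
def code : CounterOp → ℕ
  | inc r => 3 * r
  | dec r => 3 * r + 1
  | zero r => 3 * r + 2

theorem code_injective : Function.Injective code := by
  intro a b h
  cases a <;> cases b <;> simp only [code] at h <;> first | omega | (congr 1; omega)

end CounterOp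

/-- A transition of a counter machine, from the control state `src` to `tgt`. -/
structure Transition where
  src : ℕ
  op : CounterOp
  tgt : ℕ

namespace Transition

/-- A numbering of the transitions. -/
def code (t : Transition) : ℕ := Nat.pair t.src (Nat.pair t.op.code t.tgt)

theorem code_injective : Function.Injective code := by
  rintro ⟨a, b, c⟩ ⟨a', b', c'⟩ h
  simp only [code, Nat.pair_eq_pair] at h
  obtain ⟨rfl, h, rfl⟩ := h
  rw [CounterOp.code_injective h]

/-- The transition that loads one unit of the input and goes on loading. -/
def load : Transition := ⟨0, .inc 0, 0⟩

/-- The transition that loads the last unit of the input and starts the program. -/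
def last : Transition := ⟨0, .inc 0, 1⟩

end Transition

/-- `M` has an infinite run that first loads `n + 1` into register `0`. -/
def HasRun (M : List Transition) (n : ℕ) : Prop :=
  ∃ (t : ℕ → Transition) (s : ℕ → ℕ → ℕ),
    (∀ m, t m ∈ Transition.load :: Transition.last :: M) ∧
    (t 0).src = 0 ∧ (s 0 = fun _ => 0) ∧
    (∀ m, (t m).tgt = (t (m + 1)).src) ∧
    (∀ m, (t m).op.Rel (s m) (s (m + 1))) ∧
    -- If no transition of `M` leaves state 0, these two conditions force `load` in the first `n`
    -- steps and `last` in step `n`, hence `n + 1` units in all.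
    (∀ m, t m = Transition.load → m < n) ∧
    (∀ m, t m = Transition.last → n ≤ m)

/-! ### Loop programs -/

/-- Structured counter programs; `loop r P` runs `P`, decreasing `r` before each round, until `r`
is zero. -/
inductive LoopProg : Type
  | inc (r : ℕ) : LoopProg
  | clear (r : ℕ) : LoopProg
  | seq (P Q : LoopProg) : LoopProg
  | loop (r : ℕ) (P : LoopProg) : LoopProg

namespace LoopProg

/-- Big-step semantics. -/
inductive Exec : LoopProg → (ℕ → ℕ) → (ℕ → ℕ) → Prop
  | inc {r s} : Exec (inc r) s (Function.update s r (s r + 1))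
  | clear {r s} : Exec (clear r) s (Function.update s r 0)
  | seq {P Q s s' s''} : Exec P s s' → Exec Q s' s'' → Exec (seq P Q) s s''
  | loop_zero {r P s} : s r = 0 → Exec (loop r P) s s
  | loop_succ {r P s k s' s''} : s r = k + 1 → Exec P (Function.update s r k) s' →
      Exec (loop r P) s' s'' → Exec (loop r P) s s''

/-- The number of control states used by a program. -/
def size : LoopProg → ℕ
  | inc _ => 1
  | clear _ => 1
  | seq P Q => P.size + Q.size
  | loop _ P => P.size + 1

/-- The transition table of a program with entry `a` and exit `e`. -/
def table : LoopProg → ℕ → ℕ → List Transition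
  | inc r, a, e => [⟨a, .inc r, e⟩]
  | clear r, a, e => [⟨a, .dec r, a⟩, ⟨a, .zero r, e⟩]
  | seq P Q, a, e => P.table a (a + P.size) ++ Q.table (a + P.size) e
  | loop r P, a, e => ⟨a, .dec r, a + 1⟩ :: ⟨a, .zero r, e⟩ :: P.table (a + 1) a

/-- Each subprogram owns a block of consecutive states, so the state alone tells which table a
transition comes from, and an exit outside the block has no transition of its own. -/
theorem src_of_mem_table (P : LoopProg) (a e : ℕ) (t : Transition) (ht : t ∈ P.table a e) :
    a ≤ t.src ∧ t.src < a + P.size := by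
  induction P generalizing a e with
  | inc r => simp only [table, List.mem_singleton] at ht; subst ht; simp [size]
  | clear r =>
    simp only [table, List.mem_cons, List.not_mem_nil, or_false] at ht
    rcases ht with rfl | rfl <;> simp [size]
  | seq P Q ihP ihQ =>
    simp only [table, List.mem_append] at ht
    rcases ht with h | h
    · have := ihP _ _ h; simp only [size]; omega
    · have := ihQ _ _ h; simp only [size]; omega
  | loop r P ih =>
    simp only [table, List.mem_cons] at ht
    rcases ht with rfl | rfl | h
    · simp [size]
    · simp [size]
    · have := ih _ _ h; simp only [size]; omega

/-- One step of the machine with table `M`. -/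
def MachineStep (M : List Transition) (c c' : ℕ × (ℕ → ℕ)) : Prop :=
  ∃ t ∈ M, t.src = c.1 ∧ t.op.Rel c.2 c'.2 ∧ t.tgt = c'.1

theorem clear_transGen (M : List Transition) (r a e : ℕ)
    (hM : ∀ t ∈ (clear r).table a e, t ∈ M) (k : ℕ) (s : ℕ → ℕ) (hk : s r = k) :
    Relation.TransGen (MachineStep M) (a, s) (e, Function.update s r 0) := by
  induction k generalizing s with
  | zero =>
    refine .single ⟨⟨a, .zero r, e⟩, hM _ (by simp [table]), rfl, ?_, rfl⟩
    refine ⟨hk, ?_⟩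
    rw [← hk]; exact Function.update_eq_self r s
  | succ k ih =>
    refine .head (b := (a, Function.update s r (s r - 1))) ⟨⟨a, .dec r, a⟩, hM _ (by simp [table]), rfl,
      ⟨by simp [hk], rfl⟩, rfl⟩ ?_
    have := ih (Function.update s r (s r - 1)) (by simp [hk])
    simpa using this

/-- A terminating execution is carried out by the machine. -/
theorem Exec.transGen {M : List Transition} {P : LoopProg} {s s' : ℕ → ℕ} (h : Exec P s s')
    (a e : ℕ) (hM : ∀ t ∈ P.table a e, t ∈ M) :
    Relation.TransGen (MachineStep M) (a, s) (e, s') := by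
  induction h generalizing a e with
  | @inc r s => exact .single ⟨⟨a, .inc r, e⟩, hM _ (by simp [table]), rfl, rfl, rfl⟩
  | clear => exact clear_transGen M _ a e hM _ _ rfl
  | @seq P Q _ _ _ _ _ ih1 ih2 =>
    exact (ih1 a (a + P.size) fun t ht => hM t (by simp [table, ht])).trans
      (ih2 (a + P.size) e fun t ht => hM t (by simp [table, ht]))
  | @loop_zero r P s h0 =>
    exact .single ⟨⟨a, .zero r, e⟩, hM _ (by simp [table]), rfl, ⟨h0, rfl⟩, rfl⟩
  | @loop_succ r P s k s' s'' hk _ _ ih1 ih2 =>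
    refine .head (b := (a + 1, Function.update s r k))
      ⟨⟨a, .dec r, a + 1⟩, hM _ (by simp [table]), rfl, ⟨by simp [hk], ?_⟩, rfl⟩
      ((ih1 _ _ fun t ht => hM t (by simp [table, ht])).trans (ih2 _ _ hM))
    simp [hk]

/-- An infinite run that enters the table of `P` follows every terminating execution of `P`. -/
theorem Exec.of_run {t : ℕ → Transition} {s : ℕ → ℕ → ℕ}
    (hlink : ∀ m, (t m).tgt = (t (m + 1)).src)
    (hrel : ∀ m, (t m).op.Rel (s m) (s (m + 1)))
    {P : LoopProg} {σ σ' : ℕ → ℕ} (h : Exec P σ σ') (a e : ℕ)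
    (hM : ∀ m, a ≤ (t m).src → (t m).src < a + P.size → t m ∈ P.table a e)
    (m : ℕ) (hsrc : (t m).src = a) (hs : s m = σ) :
    ∃ m', (t m').src = e ∧ s m' = σ' := by
  induction h generalizing a e m with
  | @inc r σ =>
    have h1 := hM m (by omega) (by simp [size, hsrc])
    simp only [table, List.mem_singleton] at h1
    refine ⟨m + 1, ?_, ?_⟩
    · rw [← hlink, h1]
    · have := hrel m
      rw [h1, hs] at this
      exact this
  | @clear r σ =>
    -- A single step of `Exec` is many machine steps here, whence a second induction, on the content
    -- of `r`.
    obtain ⟨k, hk⟩ : ∃ k, σ r = k := ⟨_, rfl⟩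
    induction k generalizing m σ with
    | zero =>
      have h1 := hM m (by omega) (by simp [size, hsrc])
      simp only [table, List.mem_cons, List.not_mem_nil, or_false] at h1
      have h2 := hrel m
      rcases h1 with h1 | h1
      · rw [h1, hs] at h2
        exact absurd hk h2.1
      · rw [h1, hs] at h2
        refine ⟨m + 1, by rw [← hlink, h1], ?_⟩
        rw [h2.2, ← hk, Function.update_eq_self]
    | succ k ih =>
      have h1 := hM m (by omega) (by simp [size, hsrc])
      simp only [table, List.mem_cons, List.not_mem_nil, or_false] at h1
      have h2 := hrel m
      rcases h1 with h1 | h1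
      · rw [h1, hs] at h2
        obtain ⟨m', h3, h4⟩ := ih (m := m + 1) (by rw [← hlink, h1]) h2.2 (by simp [hk])
        exact ⟨m', h3, by simpa using h4⟩
      · rw [h1, hs] at h2
        have : σ r = 0 := h2.1
        omega
  | @seq P Q _ _ _ _ _ ih1 ih2 =>
    obtain ⟨m', h1, h2⟩ := ih1 a (a + P.size) (fun m h3 h4 => by
      have h5 := hM m h3 (by simp only [size]; omega)
      simp only [table, List.mem_append] at h5
      rcases h5 with h5 | h5
      · exact h5
      · have := src_of_mem_table _ _ _ _ h5; omega) m hsrc hs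
    exact ih2 (a + P.size) e (fun m h3 h4 => by
      have h5 := hM m (by omega) (by simp only [size]; omega)
      simp only [table, List.mem_append] at h5
      rcases h5 with h5 | h5
      · have := src_of_mem_table _ _ _ _ h5; omega
      · exact h5) m' h1 h2
  | @loop_zero r P σ h0 =>
    have h1 := hM m (by omega) (by simp only [size]; omega)
    simp only [table, List.mem_cons] at h1
    have h2 := hrel m
    rcases h1 with h1 | h1 | h1
    · rw [h1, hs] at h2
      exact absurd h0 h2.1
    · rw [h1, hs] at h2
      exact ⟨m + 1, by rw [← hlink, h1], h2.2⟩
    · have := src_of_mem_table _ _ _ _ h1; omega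
  | @loop_succ r P σ k σ' σ'' hk _ _ ih1 ih2 =>
    have h1 := hM m (by omega) (by simp only [size]; omega)
    simp only [table, List.mem_cons] at h1
    have h2 := hrel m
    rcases h1 with h1 | h1 | h1
    · rw [h1, hs] at h2
      obtain ⟨m', h3, h4⟩ := ih1 (a + 1) a (fun m h3 h4 => by
        have h5 := hM m (by omega) (by simp only [size]; omega)
        simp only [table, List.mem_cons] at h5
        rcases h5 with h5 | h5 | h5
        · rw [h5] at h3; simp at h3
        · rw [h5] at h3; simp at h3
        · exact h5) (m + 1) (by rw [← hlink, h1]) (by rw [h2.2]; simp [hk])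
      exact ih2 a e hM m' h3 h4
    · rw [h1, hs] at h2
      have : σ r = 0 := h2.1
      omega
    · have := src_of_mem_table _ _ _ _ h1; omega

/-! ### Primitive recursive functions are computed by loop programs -/

/-- `copy a b c` copies register `a` to `b`, using `c`. -/
def copy (a b c : ℕ) : LoopProg :=
  seq (clear b) (seq (clear c) (seq (loop a (inc c)) (loop c (seq (inc a) (inc b)))))

theorem exec_move {a c : ℕ} (hac : a ≠ c) (k : ℕ) (s : ℕ → ℕ) (hk : s a = k) :
    ∃ s', Exec (loop a (inc c)) s s' ∧ s' a = 0 ∧ s' c = s c + k ∧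
      ∀ r, r ≠ a → r ≠ c → s' r = s r := by
  induction k generalizing s with
  | zero => exact ⟨s, .loop_zero hk, hk, rfl, fun _ _ _ => rfl⟩
  | succ k ih =>
    obtain ⟨s', h1, h2, h3, h4⟩ := ih _ (show (Function.update (Function.update s a k) c
      (Function.update s a k c + 1)) a = k by simp [hac])
    refine ⟨s', .loop_succ hk .inc h1, h2, ?_, fun r hr hr' => ?_⟩
    · rw [h3]; simp [hac.symm]; omega
    · rw [h4 r hr hr']; simp [hr, hr']

theorem exec_move_two {a b c : ℕ} (hac : a ≠ c) (hbc : b ≠ c) (hab : a ≠ b) (k : ℕ) (s : ℕ → ℕ)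
    (hk : s c = k) :
    ∃ s', Exec (loop c (seq (inc a) (inc b))) s s' ∧ s' a = s a + k ∧ s' b = s b + k ∧
      ∀ r, r ≠ a → r ≠ b → r ≠ c → s' r = s r := by
  induction k generalizing s with
  | zero => exact ⟨s, .loop_zero hk, rfl, rfl, fun _ _ _ _ => rfl⟩
  | succ k ih =>
    obtain ⟨s₁, hs₁⟩ : ∃ s₁, s₁ = Function.update (Function.update s c k) a
      (Function.update s c k a + 1) := ⟨_, rfl⟩
    obtain ⟨s₂, hs₂⟩ : ∃ s₂, s₂ = Function.update s₁ b (s₁ b + 1) := ⟨_, rfl⟩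
    obtain ⟨s', h1, h2, h3, h4⟩ := ih s₂ (by simp [hs₁, hs₂, hac.symm, hbc.symm])
    refine ⟨s', .loop_succ hk (.seq (s' := s₁) ?_ (s'' := s₂) ?_) h1, ?_, ?_, fun r hr hr' hr'' => ?_⟩
    · rw [hs₁]; exact .inc
    · rw [hs₂]; exact .inc
    · rw [h2, hs₂, hs₁]; simp [hac, hab]; omega
    · rw [h3, hs₂, hs₁]; simp [hbc, hab.symm]; omega
    · rw [h4 r hr hr' hr'', hs₂, hs₁]; simp [hr, hr', hr'']

/-- Reading a register destroys it: the content is moved to `c` and then poured back into both `a`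
and `b`. -/
theorem exec_copy {a b c : ℕ} (hac : a ≠ c) (hbc : b ≠ c) (hab : a ≠ b) (s : ℕ → ℕ) :
    ∃ s', Exec (copy a b c) s s' ∧ s' b = s a ∧ ∀ r, r ≠ b → r ≠ c → s' r = s r := by
  obtain ⟨s₁, hs₁⟩ : ∃ s₁, s₁ = Function.update (Function.update s b 0) c 0 := ⟨_, rfl⟩
  obtain ⟨s₂, e2, h1, h2, h3⟩ := exec_move hac _ s₁ rfl
  obtain ⟨s₃, e3, h4, h5, h6⟩ := exec_move_two hac hbc hab _ s₂ rfl
  refine ⟨s₃, .seq .clear (.seq (hs₁ ▸ .clear) (.seq e2 e3)), ?_, fun r hr hr' => ?_⟩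
  · rw [h5, h3 b hab.symm hbc, h2, hs₁]; simp [hac, hab, hbc]
  · by_cases hra : r = a
    · subst hra
      rw [h4, h1, h2, hs₁]; simp [hac, hab]
    · rw [h6 r hra hr hr', h3 r hra hr', hs₁]; simp [hr, hr']

/-- `f` is computed by loop programs, for all choices of the registers for the arguments and the
value; the registers from `base` on are scratch space. -/
def Computes {n : ℕ} (f : List.Vector ℕ n → ℕ) : Prop :=
  ∀ (ins : Fin n → ℕ) (out base : ℕ), (∀ i, ins i < base) → (∀ i, ins i ≠ out) → out < base →
    ∃ P : LoopProg, ∀ s : ℕ → ℕ, ∃ s', Exec P s s' ∧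
      s' out = f (List.Vector.ofFn fun i => s (ins i)) ∧ ∀ r < base, r ≠ out → s' r = s r

/-- The values go to the registers from `base` on, while every subprogram takes its scratch space
from `base + n` on, so that values already computed survive. -/
theorem computes_family {m n : ℕ} (g : Fin n → List.Vector ℕ m → ℕ) (hg : ∀ i, Computes (g i))
    (ins : Fin m → ℕ) (base : ℕ) (hins : ∀ i, ins i < base) (j : ℕ) (hj : j ≤ n) :
    ∃ P : LoopProg, ∀ s : ℕ → ℕ, ∃ s', Exec P s s' ∧
      (∀ i : Fin n, (i : ℕ) < j → s' (base + i) = g i (List.Vector.ofFn fun i => s (ins i))) ∧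
      ∀ r < base, s' r = s r := by
  induction j with
  | zero =>
    -- There is no empty program; clearing a scratch register takes its place.
    refine ⟨clear base, fun s => ⟨_, .clear, fun i hi => absurd hi (by omega), fun r hr => ?_⟩⟩
    simp [hr.ne]
  | succ j ih =>
    obtain ⟨P, hP⟩ := ih (by omega)
    obtain ⟨Q, hQ⟩ := hg ⟨j, hj⟩ ins (base + j) (base + n)
      (fun i => by have := hins i; omega) (fun i => by have := hins i; omega) (by omega)
    refine ⟨seq P Q, fun s => ?_⟩
    obtain ⟨s₁, e1, h1, h2⟩ := hP s
    obtain ⟨s₂, e2, h3, h4⟩ := hQ s₁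
    refine ⟨s₂, .seq e1 e2, fun i hi => ?_, fun r hr => ?_⟩
    · by_cases hij : (i : ℕ) = j
      · have : i = ⟨j, hj⟩ := Fin.ext hij
        subst this
        rw [h3]
        congr 2
        funext k
        exact h2 _ (hins k)
      · rw [h4 _ (by omega) (by omega), h1 i (by omega)]
    · rw [h4 r (by omega) (by omega), h2 r hr]

theorem computes_of_primrec' {n : ℕ} {f : List.Vector ℕ n → ℕ} (hf : Nat.Primrec' f) :
    Computes f := by
  induction hf with
  | zero =>
    intro ins out base _ _ _
    exact ⟨clear out, fun s => ⟨_, .clear, by simp, fun r _ hr => by simp [hr]⟩⟩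
  | succ =>
    intro ins out base h1 h2 h3
    refine ⟨seq (copy (ins 0) out base) (inc out), fun s => ?_⟩
    obtain ⟨s', e, h4, h5⟩ := exec_copy (a := ins 0) (b := out) (c := base) (h1 0).ne h3.ne (h2 0) s
    refine ⟨_, .seq e .inc, ?_, fun r hr hr' => ?_⟩
    · simp [h4, List.Vector.ofFn]
    · simp [hr', h5 r hr' hr.ne]
  | get i =>
    intro ins out base h1 h2 h3
    refine ⟨copy (ins i) out base, fun s => ?_⟩
    obtain ⟨s', e, h4, h5⟩ := exec_copy (a := ins i) (b := out) (c := base) (h1 i).ne h3.ne (h2 i) s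
    exact ⟨s', e, by simp [h4], fun r hr hr' => h5 r hr' hr.ne⟩
  | @comp m n f g _ _ ihf ihg =>
    intro ins out base h1 h2 h3
    obtain ⟨P, hP⟩ := computes_family g ihg ins base h1 _ le_rfl
    obtain ⟨Q, hQ⟩ := ihf (fun i => base + i) out (base + n) (fun i => by omega)
      (fun i => by omega) (by omega)
    refine ⟨seq P Q, fun s => ?_⟩
    obtain ⟨s₁, e1, h4, h5⟩ := hP s
    obtain ⟨s₂, e2, h6, h7⟩ := hQ s₁
    refine ⟨s₂, .seq e1 e2, ?_, fun r hr hr' => ?_⟩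
    · rw [h6]
      congr 2
      funext i
      exact h4 i i.2
    · rw [h7 r (by omega) hr', h5 r hr]
  | @prec n f g _ _ ihf ihg =>
    intro ins out base h1 h2 h3
    have hb : ∀ i, ins i < base := h1
    -- In the recursion `base` counts the remaining rounds, `base + 1` is the recursion variable,
    -- `base + 2` the value reached and `base + 3` the next value; scratch space starts at `base +
    -- 4`.
    obtain ⟨P, hP⟩ := ihf (fun i => ins i.succ) (base + 2) (base + 4)
      (fun i => by have := hb i.succ; omega) (fun i => by have := hb i.succ; omega) (by omega)
    obtain ⟨Q, hQ⟩ := ihg (Fin.cons (base + 1) (Fin.cons (base + 2) fun i => ins i.succ))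
      (base + 3) (base + 4)
      (fun i => by
        refine Fin.cases ?_ (fun i => Fin.cases ?_ (fun i => ?_) i) i
        · simp
        · simp
        · have := hb i.succ; simp only [Fin.cons_succ]; omega)
      (fun i => by
        refine Fin.cases ?_ (fun i => Fin.cases ?_ (fun i => ?_) i) i
        · simp
        · simp
        · have := hb i.succ; simp only [Fin.cons_succ]; omega) (by omega)
    have key : ∀ (v : List.Vector ℕ n) (k y : ℕ) (s : ℕ → ℕ), s base = k → s (base + 1) = y →
        s (base + 2) = Nat.rec (f v) (fun y IH => g (y ::ᵥ IH ::ᵥ v)) y →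
        (List.Vector.ofFn fun i : Fin n => s (ins i.succ)) = v →
        ∃ s', Exec (loop base (seq Q (seq (copy (base + 3) (base + 2) (base + 4))
            (inc (base + 1))))) s s' ∧
          s' (base + 2) = Nat.rec (f v) (fun y IH => g (y ::ᵥ IH ::ᵥ v)) (y + k) ∧
          ∀ r < base, s' r = s r := by
      intro v k
      induction k with
      | zero =>
        intro y s h4 h5 h6 _
        exact ⟨s, .loop_zero h4, h6, fun _ _ => rfl⟩
      | succ k ih =>
        intro y s h4 h5 h6 hv
        obtain ⟨s₁, e1, h7, h8⟩ := hQ (Function.update s base k)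
        obtain ⟨s₂, e2, h9, h10⟩ := exec_copy (a := base + 3) (b := base + 2) (c := base + 4)
          (by omega) (by omega) (by omega) s₁
        obtain ⟨s₃, hs₃⟩ : ∃ s₃, s₃ = Function.update s₂ (base + 1) (s₂ (base + 1) + 1) := ⟨_, rfl⟩
        have hlow : ∀ r < base, s₃ r = s r := fun r hr => by
          rw [hs₃, Function.update_of_ne (by omega), h10 r (by omega) (by omega),
            h8 r (by omega) (by omega), Function.update_of_ne (by omega)]
        obtain ⟨s₄, e4, h11, h12⟩ := ih (y + 1) s₃
          (by rw [hs₃, Function.update_of_ne (by omega), h10 _ (by omega) (by omega),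
            h8 _ (by omega) (by omega), Function.update_self])
          (by rw [hs₃, Function.update_self, h10 _ (by omega) (by omega),
            h8 _ (by omega) (by omega), Function.update_of_ne (by omega), h5])
          (by
            rw [hs₃, Function.update_of_ne (by omega), h9, h7, List.Vector.ofFn, List.Vector.ofFn]
            simp only [Fin.cons_zero, Fin.cons_succ]
            rw [Function.update_of_ne (by omega), Function.update_of_ne (by omega), h5, h6]
            have : (List.Vector.ofFn fun i : Fin n => Function.update s base k (ins i.succ))
                = v := by
              rw [← hv]
              congr 1
              funext i
              rw [Function.update_of_ne (hb i.succ).ne]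
            rw [this])
          (by
            rw [← hv]
            congr 1
            funext i
            exact hlow _ (hb i.succ))
        refine ⟨s₄, .loop_succ h4 (.seq e1 (.seq e2 (hs₃ ▸ .inc))) e4, ?_, fun r hr => ?_⟩
        · rw [h11, show y + 1 + k = y + (k + 1) by omega]
        · rw [h12 r hr, hlow r hr]
    refine ⟨seq P (seq (copy (ins 0) base (base + 4)) (seq (clear (base + 1))
      (seq (loop base (seq Q (seq (copy (base + 3) (base + 2) (base + 4)) (inc (base + 1)))))
        (copy (base + 2) out (base + 4))))), fun s => ?_⟩
    obtain ⟨s₁, e1, h4, h5⟩ := hP s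
    obtain ⟨s₂, e2, h6, h7⟩ := exec_copy (a := ins 0) (b := base) (c := base + 4)
      (by have := hb 0; omega) (by omega) (hb 0).ne s₁
    obtain ⟨s₃, hs₃⟩ : ∃ s₃, s₃ = Function.update s₂ (base + 1) 0 := ⟨_, rfl⟩
    have hlow : ∀ r < base, s₃ r = s r := fun r hr => by
      rw [hs₃, Function.update_of_ne (by omega), h7 r (by omega) (by omega),
        h5 r (by omega) (by omega)]
    obtain ⟨s₄, e4, h8, h9⟩ := key (List.Vector.ofFn fun i => s (ins i.succ)) (s (ins 0)) 0 s₃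
      (by rw [hs₃, Function.update_of_ne (by omega), h6, h5 _ (by have := hb 0; omega)
        (by have := hb 0; omega)])
      (by rw [hs₃, Function.update_self])
      (by
        show s₃ (base + 2) = f (List.Vector.ofFn fun i => s (ins i.succ))
        rw [hs₃, Function.update_of_ne (by omega), h7 _ (by omega) (by omega), h4])
      (by
        congr 1
        funext i
        exact hlow _ (hb i.succ))
    obtain ⟨s₅, e5, h10, h11⟩ := exec_copy (a := base + 2) (b := out) (c := base + 4)
      (by omega) (by omega) (by omega) s₄
    refine ⟨s₅, .seq e1 (.seq e2 (.seq (hs₃ ▸ .clear) (.seq e4 e5))), ?_, fun r hr hr' => ?_⟩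
    · rw [h10, h8, List.Vector.ofFn, Nat.zero_add]
      simp
    · rw [h11 r hr' (by omega), h9 r hr, hlow r hr]

/-! ### An undecidable counter machine problem -/

/-- A search: `body` computes a value in register `2`, and is repeated, increasing register `1`,
until the value is zero. -/
def search (body : LoopProg) : LoopProg := seq (inc 2) (loop 2 (seq body (inc 1)))

end LoopProg

open LoopProg

/-- The invariant of the single steps is that some `A k` is still reachable; `A k` itself can always
be left, since the path to `A (k + 1)` is not empty. -/
theorem Relation.TransGen.exists_infinite {α : Type*} {r : α → α → Prop} (A : ℕ → α)
    (h : ∀ k, Relation.TransGen r (A k) (A (k + 1))) (c : α) (hc : Relation.ReflTransGen r c (A 0)) :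
    ∃ ρ : ℕ → α, ρ 0 = c ∧ ∀ m, r (ρ m) (ρ (m + 1)) := by
  have next : ∀ x : {x : α // ∃ k, Relation.ReflTransGen r x (A k)},
      ∃ y : {x : α // ∃ k, Relation.ReflTransGen r x (A k)}, r x y := by
    rintro ⟨x, k, hx⟩
    have hx' := Relation.TransGen.trans_right hx (h k)
    obtain ⟨y, h1, h2⟩ := Relation.TransGen.head'_iff.1 hx'
    exact ⟨⟨y, k + 1, h2⟩, h1⟩
  choose f hf using next
  refine ⟨fun m => (f^[m] ⟨c, 0, hc⟩ : _), rfl, fun m => ?_⟩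
  simp only [Function.iterate_succ_apply']
  exact hf _

/-- The program tries all `k` in turn. A zero leads it to its exit, a state without transitions, so
the run is stuck; without a zero each round is followed by another. Register 0 holds the input, 1
the candidate `k`, 2 the value of `f`. -/
theorem exists_hasRun_iff (f : ℕ → ℕ → ℕ) (hf : Primrec₂ f) :
    ∃ M : List Transition, ∀ n, HasRun M n ↔ ∀ k, f k (n + 1) ≠ 0 := by
  obtain ⟨B, hB⟩ := computes_of_primrec' (Nat.Primrec'.prim_iff₂.2 hf) ![1, 0] 2 3
    (by intro i; fin_cases i <;> simp) (by intro i; fin_cases i <;> simp) (by omega)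
  have hB' : ∀ s : ℕ → ℕ, ∃ s', Exec (seq B (inc 1)) s s' ∧ s' 2 = f (s 1) (s 0) ∧
      s' 1 = s 1 + 1 ∧ s' 0 = s 0 := by
    intro s
    obtain ⟨s', e, h1, h2⟩ := hB s
    refine ⟨_, .seq e .inc, ?_, ?_, ?_⟩
    · simp [h1, List.Vector.ofFn]
    · simp [h2]
    · simp [h2]
  have htab := src_of_mem_table (search B) 1 (1 + (search B).size)
  refine ⟨(search B).table 1 (1 + (search B).size), fun n => ⟨?_, ?_⟩⟩
  · rintro ⟨t, s, hmem, h0, hs0, hlink, hrel, hload, hlast⟩ k hk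
    have hpre : ∀ m ≤ n, (t m).src = 0 ∧ s m = Function.update (fun _ => 0) 0 m := by
      intro m
      induction m with
      | zero => intro _; exact ⟨h0, by rw [hs0]; simp⟩
      | succ m ih =>
        intro hm
        obtain ⟨h1, h2⟩ := ih (by omega)
        have h3 : t m = Transition.load := by
          rcases List.mem_cons.1 (hmem m) with h | h
          · exact h
          rcases List.mem_cons.1 h with h | h
          · have := hlast m h; omega
          · have := htab _ h; omega
        have h4 := hrel m
        rw [h3, h2] at h4
        refine ⟨by rw [← hlink, h3]; rfl, ?_⟩
        rw [show s (m + 1) = _ from h4]; simp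
    have hn : t n = Transition.last := by
      rcases List.mem_cons.1 (hmem n) with h | h
      · have := hload n h; omega
      rcases List.mem_cons.1 h with h | h
      · exact h
      · have := htab _ h; have := (hpre n le_rfl).1; omega
    have hstart : (t (n + 1)).src = 1 := by rw [← hlink, hn]; rfl
    have hsn : s (n + 1) = Function.update (fun _ => 0) 0 (n + 1) := by
      have h4 := hrel n
      rw [hn, (hpre n le_rfl).2] at h4
      rw [show s (n + 1) = _ from h4]; simp
    -- Induction on the distance from register 1 to the zero `k`; the search may already stop at an
    -- earlier zero.
    have loop_exec : ∀ j, ∀ σ : ℕ → ℕ, σ 1 + j = k → σ 0 = n + 1 → σ 2 ≠ 0 →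
        ∃ σ', Exec (loop 2 (seq B (inc 1))) σ σ' := by
      intro j
      induction j with
      | zero =>
        intro σ h1 h2 h3
        obtain ⟨i, hi⟩ := Nat.exists_eq_succ_of_ne_zero h3
        obtain ⟨σ₁, e1, h4, h5, h6⟩ := hB' (Function.update σ 2 i)
        simp only [ne_eq, OfNat.one_ne_ofNat, not_false_eq_true, Function.update_of_ne,
          OfNat.zero_ne_ofNat] at h4
        exact ⟨σ₁, .loop_succ hi e1 (.loop_zero (by rw [h4, h2, show σ 1 = k by omega, hk]))⟩
      | succ j ih =>
        intro σ h1 h2 h3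
        obtain ⟨i, hi⟩ := Nat.exists_eq_succ_of_ne_zero h3
        obtain ⟨σ₁, e1, h4, h5, h6⟩ := hB' (Function.update σ 2 i)
        simp only [ne_eq, OfNat.one_ne_ofNat, not_false_eq_true, Function.update_of_ne,
          OfNat.zero_ne_ofNat] at h4 h5 h6
        by_cases hz : σ₁ 2 = 0
        · exact ⟨σ₁, .loop_succ hi e1 (.loop_zero hz)⟩
        · obtain ⟨σ₂, e2⟩ := ih σ₁ (by omega) (by omega) hz
          exact ⟨σ₂, .loop_succ hi e1 e2⟩
    obtain ⟨σ', e⟩ := loop_exec k (Function.update (s (n + 1)) 2 (s (n + 1) 2 + 1))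
      (by rw [hsn]; simp) (by rw [hsn]; simp) (by simp)
    -- The run must follow the terminating execution to the exit state, which no transition leaves.
    obtain ⟨m', h1, -⟩ := Exec.of_run hlink hrel (P := search B) (.seq .inc e) 1
      (1 + (search B).size) (fun m h1 h2 => by
        rcases List.mem_cons.1 (hmem m) with h | h
        · rw [h] at h1; simp [Transition.load] at h1
        rcases List.mem_cons.1 h with h | h
        · rw [h] at h1; simp [Transition.last] at h1
        · exact h) (n + 1) hstart rfl
    rcases List.mem_cons.1 (hmem m') with h | h
    · rw [h] at h1; simp [Transition.load] at h1; omega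
    rcases List.mem_cons.1 h with h | h
    · rw [h] at h1; simp [Transition.last] at h1; omega
    · have := htab _ h; omega
  · intro hk
    set M := (search B).table 1 (1 + (search B).size) with hM
    obtain ⟨σ₀, hσ₀⟩ : ∃ σ : ℕ → ℕ, σ = Function.update (fun _ => 0) 0 (n + 1) := ⟨_, rfl⟩
    obtain ⟨a, ha⟩ : ∃ a, a = 1 + (LoopProg.inc 2).size := ⟨_, rfl⟩
    have hsub : ∀ t ∈ (loop 2 (seq B (inc 1))).table a (1 + (search B).size), t ∈ M := by
      intro t ht
      rw [hM, search, table, List.mem_append, ← ha]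
      exact Or.inr ht
    -- A round preserves the input and, in the absence of zeros, leaves register 2 non-zero, so
    -- rounds can be iterated forever.
    have round : ∀ σ : {σ : ℕ → ℕ // σ 0 = n + 1 ∧ σ 2 ≠ 0},
        ∃ σ' : {σ : ℕ → ℕ // σ 0 = n + 1 ∧ σ 2 ≠ 0},
        Relation.TransGen (MachineStep M) (a, σ.1) (a, σ'.1) := by
      rintro ⟨σ, h1, h2⟩
      obtain ⟨i, hi⟩ := Nat.exists_eq_succ_of_ne_zero h2
      obtain ⟨σ₁, e1, h4, h5, h6⟩ := hB' (Function.update σ 2 i)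
      simp only [ne_eq, OfNat.one_ne_ofNat, not_false_eq_true, Function.update_of_ne,
        OfNat.zero_ne_ofNat] at h4 h5 h6
      refine ⟨⟨σ₁, by omega, by rw [h4, h1]; exact hk _⟩, ?_⟩
      refine .head (b := (a + 1, Function.update σ 2 i))
        ⟨⟨a, .dec 2, a + 1⟩, hsub _ (by simp [table]), rfl, ⟨by simp [hi], by simp [hi]⟩, rfl⟩
        (e1.transGen _ _ fun t ht => hsub t (by rw [table]; simp [ht]))
    choose next hnext using round
    obtain ⟨b, hb⟩ : ∃ b : {σ : ℕ → ℕ // σ 0 = n + 1 ∧ σ 2 ≠ 0},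
        b.1 = Function.update σ₀ 2 (σ₀ 2 + 1) :=
      ⟨⟨Function.update σ₀ 2 (σ₀ 2 + 1), by simp [hσ₀], by simp⟩, rfl⟩
    obtain ⟨ρ, h0, hρ⟩ := Relation.TransGen.exists_infinite (fun k => (a, (next^[k] b).1))
      (fun k => by simp only [Function.iterate_succ_apply']; exact hnext _) (1, σ₀)
      (by
        refine .single ⟨⟨1, .inc 2, a⟩, ?_, rfl, ?_, rfl⟩
        · rw [hM, search, table, List.mem_append, ← ha]
          exact Or.inl (by simp [table])
        · exact hb)
    choose τ hτ h1 h2 h3 using hρ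
    -- Loading takes steps 0 to `n`, so the steps of the program proper are shifted by `n + 1`.
    refine ⟨fun m => if m < n then .load else if m = n then .last else τ (m - (n + 1)),
      fun m => if m ≤ n then Function.update (fun _ => 0) 0 m else (ρ (m - (n + 1))).2,
      fun m => ?_, ?_, ?_, fun m => ?_, fun m => ?_, fun m hm => ?_, fun m hm => ?_⟩
    · dsimp only
      split_ifs <;> simp [hτ]
    · dsimp only
      split_ifs
      · rfl
      · rfl
      · omega
    · simp
    · dsimp only
      rcases lt_trichotomy m n with h | h | h
      · rw [if_pos h]
        split_ifs
        · rfl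
        · rfl
        · omega
      · rw [if_neg (by omega), if_pos h, if_neg (by omega), if_neg (by omega),
          show m + 1 - (n + 1) = 0 by omega, h1, h0]
        rfl
      · rw [if_neg (by omega), if_neg (by omega), if_neg (by omega), if_neg (by omega),
          show m + 1 - (n + 1) = m - (n + 1) + 1 by omega, h1, h3]
    · dsimp only
      rcases lt_trichotomy m n with h | h | h
      · rw [if_pos h, if_pos h.le, if_pos (by omega)]
        simp [Transition.load, CounterOp.Rel]
      · rw [if_neg (by omega), if_pos h, if_pos h.le, if_neg (by omega),
          show m + 1 - (n + 1) = 0 by omega, h0]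
        simp [Transition.last, CounterOp.Rel, hσ₀, h]
      · rw [if_neg (by omega), if_neg (by omega), if_neg (by omega), if_neg (by omega),
          show m + 1 - (n + 1) = m - (n + 1) + 1 by omega]
        exact h2 _
    · dsimp only at hm
      by_contra hmn
      rw [if_neg hmn] at hm
      split_ifs at hm with h
      · simp [Transition.load, Transition.last] at hm
      · have := htab _ (hτ (m - (n + 1)))
        rw [hm] at this
        simp [Transition.load] at this
    · by_contra hmn
      dsimp only at hm
      rw [if_pos (by omega)] at hm
      simp [Transition.load, Transition.last] at hm

/-- There is a counter machine for which it is undecidable from which inputs it has an infinite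
run. -/
theorem exists_undecidable_hasRun :
    ∃ M : List Transition, ¬ ComputablePred (HasRun M) := by
  -- Input `n` loads `n + 1` and `f` takes the one off again; so the run on `encode c` is infinite
  -- iff `c` does not halt on 0.
  obtain ⟨M, h⟩ := exists_hasRun_iff
    (fun k n => if (Nat.Partrec.Code.evaln k (Denumerable.ofNat Nat.Partrec.Code (n - 1)) 0).isSome
      then 0 else 1) (by
      have h1 : Primrec fun p : ℕ × ℕ =>
          Nat.Partrec.Code.evaln p.1 (Denumerable.ofNat Nat.Partrec.Code (p.2 - 1)) 0 :=
        Nat.Partrec.Code.primrec_evaln.comp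
          (Primrec.pair (Primrec.pair Primrec.fst ((Primrec.ofNat _).comp
            (Primrec.pred.comp Primrec.snd))) (Primrec.const 0))
      exact Primrec.ite (Primrec.eq.comp (Primrec.option_isSome.comp h1) (Primrec.const true))
        (Primrec.const 0) (Primrec.const 1))
  refine ⟨M, fun hc => ComputablePred.halting_problem 0 ?_⟩
  have h2 : ∀ c : Nat.Partrec.Code, ¬ HasRun M (Encodable.encode c) ↔ (c.eval 0).Dom := by
    intro c
    rw [h]
    simp only [Nat.add_sub_cancel, Denumerable.ofNat_encode, ne_eq, ite_eq_left_iff,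
      one_ne_zero, imp_false, not_not, not_forall, Option.isSome_iff_exists, Part.dom_iff_mem]
    constructor
    · rintro ⟨k, x, hx⟩
      exact ⟨x, Nat.Partrec.Code.evaln_complete.2 ⟨k, hx⟩⟩
    · rintro ⟨x, hx⟩
      obtain ⟨k, hk⟩ := Nat.Partrec.Code.evaln_complete.1 hx
      exact ⟨k, x, hk⟩
  have h3 : ComputablePred fun c : Nat.Partrec.Code => HasRun M (Encodable.encode c) :=
    ComputablePred.computable_iff.2 (by
      obtain ⟨g, hg, he⟩ := ComputablePred.computable_iff.1 hc
      exact ⟨fun c => g (Encodable.encode c), hg.comp Computable.encode, by funext c; rw [he]⟩)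
  exact h3.not.of_eq h2

/-! ### The reduction -/

namespace BiFormula

def falsum : BiFormula := and (var 0) (neg (var 0))

def or (φ ψ : BiFormula) : BiFormula := neg (and (neg φ) (neg ψ))

def imp (φ ψ : BiFormula) : BiFormula := neg (and φ (neg ψ))

def box0 (φ : BiFormula) : BiFormula := neg (dia0 (neg φ))

/-- `φ` holds everywhere in the column. -/
def all (φ : BiFormula) : BiFormula := and φ (neg (dia1 (neg φ)))

/-- `φ` holds somewhere in the column. -/
def ex (φ : BiFormula) : BiFormula := or φ (dia1 φ)

/-- `φ` holds exactly once in the column. -/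
def uniq (φ : BiFormula) : BiFormula := ex (and φ (neg (dia1 φ)))

/-- Finite conjunction. -/
def conj : List BiFormula → BiFormula
  | [] => neg falsum
  | φ :: l => and φ (conj l)

/-- Finite disjunction. -/
def disj : List BiFormula → BiFormula
  | [] => falsum
  | φ :: l => or φ (disj l)

/-- The two colours of ticks. -/
def colF (c : Bool) : BiFormula := var (bif c then 3 else 7)

/-- Marks the element that will be current at the next step. -/
def nxtF : BiFormula := var 11

/-- Marks the current element. -/
def nowF : BiFormula := var 15

/-- The current transition; it is recorded at the current element. -/
def letF (t : Transition) : BiFormula := var (4 * t.code + 2)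

/-- Marks the element added to counter `i`. -/
def incF (i : ℕ) : BiFormula := var (4 * i)

/-- Marks the element removed from counter `i`. -/
def decF (i : ℕ) : BiFormula := var (4 * i + 1)

def tickF : BiFormula := or (colF true) (colF false)

/-- `φ` holds now or later in a tick of colour `c`, or later than such a tick. -/
def viaF (c : Bool) (φ : BiFormula) : BiFormula := dia0 (and (colF c) (or φ (dia0 φ)))

/-- A substitute for the strict future diamond: `φ` holds at or after a tick of the other
colour. -/
def laterF (φ : BiFormula) : BiFormula :=
  or (and (colF true) (viaF false φ)) (and (colF false) (viaF true φ))

/-- At least `n` steps have been made. -/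
def depthF : ℕ → BiFormula
  | 0 => tickF
  | n + 1 => laterF (depthF n)

/-- Membership in counter `i`. -/
def counterF (i : ℕ) : BiFormula := and (laterF (incF i)) (neg (laterF (decF i)))

/-- The variables that mark elements added to or removed from counters. -/
def eventsOf (M : List Transition) : List ℕ :=
  M.flatMap fun t => [4 * t.op.reg, 4 * t.op.reg + 1]

end BiFormula

/-- The event that takes place when an action is performed. -/
def CounterOp.event : CounterOp → Option ℕ
  | inc i => some (4 * i)
  | dec i => some (4 * i + 1)
  | zero _ => none

namespace BiFormula

/-- The zero test of an action. -/
def zeroTestF : CounterOp → BiFormula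
  | .zero i => all (neg (counterF i))
  | _ => neg falsum

/-- An event takes place exactly once, or not at all. -/
def eventF (o : CounterOp) (e : ℕ) : BiFormula :=
  if o.event = some e then uniq (var e) else all (neg (var e))

/-- `φ` is true on an initial segment of a run of equally coloured ticks. -/
def persistF (φ : BiFormula) : BiFormula := imp (and tickF (dia0 φ)) (or φ (laterF φ))

/-- `φ` is true in at most one run of equally coloured ticks. -/
def onceF (φ : BiFormula) : BiFormula := imp φ (neg (laterF φ))

/-- The part of the reduction that holds at every moment and does not depend on the input. -/
def rulesF (M : List Transition) : BiFormula :=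
  conj <|
    [imp (colF true) (all (colF true)), imp (colF false) (all (colF false)),
      neg (and (colF true) (colF false)), imp tickF (ex nowF), imp tickF (ex nxtF),
      onceF nxtF, onceF nowF, imp nowF (disj (M.map letF)), imp nowF (neg nxtF),
      -- With the preceding rule and weak connectedness, the point where an element is current comes
      -- R-before the points where it is marked as next.
      imp nxtF (neg (dia0 nowF)),
      conj ((eventsOf M).map fun e => persistF (var e)),
      conj ((eventsOf M).map fun e => onceF (var e)),
      conj (M.map fun a => persistF (letF a)),
      conj (M.map fun a => imp (letF a) nowF),
      -- From the element of `a`, `dia0` leads to the preceding step, where that element is marked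
      -- as next, and `dia1` to the other element, which carries `b`.
      conj (M.map fun a => conj (M.map fun b => if b.tgt = a.src then neg falsum else
        neg (and (letF a) (dia0 (and nxtF (dia1 (letF b))))))),
      conj (M.map fun a => conj ((eventsOf M).map fun e => imp (letF a) (eventF a.op e))),
      -- This rule and the next make the counters exact: additions concern elements not removed
      -- before, removals elements added before.
      conj (M.map fun a => imp (incF a.op.reg) (neg (laterF (decF a.op.reg)))),
      conj (M.map fun a => imp (decF a.op.reg) (laterF (incF a.op.reg))),
      conj (M.map fun a => imp (letF a) (zeroTestF a.op))]

/-- The current element was marked as the next one in the preceding ticks, of colour `c`. -/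
def linkF (c : Bool) : BiFormula :=
  conj [colF !c, dia0 (and (colF c) nxtF), box0 (imp nxtF (colF c)),
    -- A tick of colour `c` with a mark still to come is itself marked. This keeps ticks of the
    -- other colour from slipping in between, see `cases_of_consecutive`.
    box0 (imp (colF c) (or nxtF (neg (dia0 nxtF))))]

/-- The first tick. -/
def startF (M : List Transition) : BiFormula :=
  conj [nowF, tickF, all (neg (laterF (neg falsum))),
    conj (M.map fun a => if a.src = 0 then neg falsum else neg (letF a))]

/-- The input dependent part of the reduction. -/
def inputF (n : ℕ) : BiFormula :=
  and (imp (letF .load) (all (neg (depthF n)))) (imp (letF .last) (ex (depthF n)))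

/-- The formula that is satisfiable iff the machine has an infinite run on input `n`. -/
def runF (M : List Transition) (n : ℕ) : BiFormula :=
  and (all (box0 (inputF n))) (and (all (box0 (rulesF M)))
    -- A step need not see its successor, but the root sees both. Evaluated there, this conjunct
    -- generates infinitely many steps.
    (and (all (imp (dia0 nxtF) (dia0 (and nowF (or (linkF true) (linkF false))))))
      (ex (dia0 (startF M)))))

end BiFormula

/-! ### Models over a grid with varying columns -/

/-- Points are pairs of a moment `t` and an element of `D t`. -/
structure GridModel (T : Type u) (V : Type v) where
  R : T → T → Prop
  D : T → Set V
  val : ℕ → T → V → Prop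

namespace GridModel

variable {T : Type u} {V : Type v} (G : GridModel T V)

/-- Truth in a grid model. -/
def Holds : BiFormula → T → V → Prop
  | .var p, t, d => G.val p t d
  | .neg φ, t, d => ¬ Holds φ t d
  | .and φ ψ, t, d => Holds φ t d ∧ Holds ψ t d
  | .dia0 φ, t, d => ∃ t', G.R t t' ∧ d ∈ G.D t' ∧ Holds φ t' d
  | .dia1 φ, t, d => ∃ d' ∈ G.D t, d' ≠ d ∧ Holds φ t d'

open BiFormula

variable {G} {φ ψ : BiFormula} {t : T} {d : V}

theorem holds_neg : G.Holds (neg φ) t d ↔ ¬ G.Holds φ t d := Iff.rfl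

theorem holds_and : G.Holds (.and φ ψ) t d ↔ G.Holds φ t d ∧ G.Holds ψ t d := Iff.rfl

theorem holds_dia0 : G.Holds (dia0 φ) t d ↔ ∃ t', G.R t t' ∧ d ∈ G.D t' ∧ G.Holds φ t' d := Iff.rfl

theorem holds_dia1 : G.Holds (dia1 φ) t d ↔ ∃ d' ∈ G.D t, d' ≠ d ∧ G.Holds φ t d' := Iff.rfl

theorem not_holds_falsum : ¬ G.Holds falsum t d := by simp [falsum, Holds]

theorem holds_verum : G.Holds (neg falsum) t d := not_holds_falsum

theorem holds_or : G.Holds (.or φ ψ) t d ↔ G.Holds φ t d ∨ G.Holds ψ t d := by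
  simp only [BiFormula.or, Holds]; tauto

theorem holds_imp : G.Holds (imp φ ψ) t d ↔ (G.Holds φ t d → G.Holds ψ t d) := by
  simp only [imp, Holds]; tauto

theorem holds_box0 :
    G.Holds (box0 φ) t d ↔ ∀ t', G.R t t' → d ∈ G.D t' → G.Holds φ t' d := by
  simp only [box0, Holds]
  push Not
  rfl

theorem holds_all (hd : d ∈ G.D t) : G.Holds (all φ) t d ↔ ∀ d' ∈ G.D t, G.Holds φ t d' := by
  simp only [all, Holds]
  push Not
  refine ⟨fun h d' hd' => ?_, fun h => ⟨h d hd, fun d' hd' _ => h d' hd'⟩⟩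
  by_cases hdd : d' = d
  · rw [hdd]; exact h.1
  · exact h.2 d' hd' hdd

theorem holds_ex (hd : d ∈ G.D t) : G.Holds (ex φ) t d ↔ ∃ d' ∈ G.D t, G.Holds φ t d' := by
  rw [ex, holds_or, holds_dia1]
  constructor
  · rintro (h | ⟨d', h, -, h'⟩)
    exacts [⟨d, hd, h⟩, ⟨d', h, h'⟩]
  · rintro ⟨d', h, h'⟩
    by_cases hdd : d' = d
    · exact Or.inl (hdd ▸ h')
    · exact Or.inr ⟨d', h, hdd, h'⟩

theorem holds_uniq (hd : d ∈ G.D t) : G.Holds (uniq φ) t d ↔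
    ∃ a ∈ G.D t, G.Holds φ t a ∧ ∀ b ∈ G.D t, G.Holds φ t b → b = a := by
  rw [uniq, holds_ex hd]
  simp only [Holds]
  push Not
  constructor
  · rintro ⟨a, h1, h2, h3⟩
    exact ⟨a, h1, h2, fun b hb h => by_contra fun hba => h3 b hb hba h⟩
  · rintro ⟨a, h1, h2, h3⟩
    exact ⟨a, h1, h2, fun b hb hba h => hba (h3 b hb h)⟩

theorem holds_conj {l : List BiFormula} : G.Holds (conj l) t d ↔ ∀ φ ∈ l, G.Holds φ t d := by
  induction l with
  | nil => simp [conj, holds_verum]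
  | cons φ l ih => simp [conj, holds_and, ih]

theorem holds_disj {l : List BiFormula} : G.Holds (disj l) t d ↔ ∃ φ ∈ l, G.Holds φ t d := by
  induction l with
  | nil => simp [disj, not_holds_falsum]
  | cons φ l ih => simp [disj, holds_or, ih]

theorem holds_tickF : G.Holds tickF t d ↔ ∃ c, G.Holds (colF c) t d := by
  rw [tickF, holds_or, Bool.exists_bool, or_comm]

theorem holds_laterF : G.Holds (laterF φ) t d ↔ ∃ c, G.Holds (colF c) t d ∧
    ∃ t', G.R t t' ∧ d ∈ G.D t' ∧ G.Holds (colF !c) t' d ∧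
      (G.Holds φ t' d ∨ G.Holds (dia0 φ) t' d) := by
  rw [laterF, holds_or, Bool.exists_bool, or_comm]
  simp only [viaF, holds_and, holds_dia0, holds_or]
  rfl

theorem holds_persistF : G.Holds (persistF φ) t d ↔
    ((∃ c, G.Holds (colF c) t d) → G.Holds (dia0 φ) t d →
      G.Holds φ t d ∨ G.Holds (laterF φ) t d) := by
  rw [persistF, holds_imp, holds_and, holds_tickF, holds_or, and_imp]

theorem holds_onceF : G.Holds (onceF φ) t d ↔
    (G.Holds φ t d → ¬ G.Holds (laterF φ) t d) := by
  rw [onceF, holds_imp, holds_neg]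

variable (G)

/-- The meaning of `rulesF`. -/
structure Rules (M : List Transition) (t : T) (d : V) : Prop where
  col_uniform : ∀ c, G.Holds (colF c) t d → ∀ d' ∈ G.D t, G.Holds (colF c) t d'
  col_exclusive : ∀ c, G.Holds (colF c) t d → ¬ G.Holds (colF !c) t d
  exists_now : ∀ c, G.Holds (colF c) t d → ∃ d' ∈ G.D t, G.Holds nowF t d'
  exists_nxt : ∀ c, G.Holds (colF c) t d → ∃ d' ∈ G.D t, G.Holds nxtF t d'
  nxt_once : G.Holds nxtF t d → ¬ G.Holds (laterF nxtF) t d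
  now_once : G.Holds nowF t d → ¬ G.Holds (laterF nowF) t d
  exists_letter : G.Holds nowF t d → ∃ a ∈ M, G.Holds (letF a) t d
  not_nxt_of_now : G.Holds nowF t d → ¬ G.Holds nxtF t d
  not_now_of_nxt : G.Holds nxtF t d → ¬ G.Holds (dia0 nowF) t d
  event_persist : ∀ e ∈ eventsOf M, G.Holds (persistF (var e)) t d
  event_once : ∀ e ∈ eventsOf M, G.Holds (var e) t d → ¬ G.Holds (laterF (var e)) t d
  letter_persist : ∀ a ∈ M, G.Holds (persistF (letF a)) t d
  now_of_letter : ∀ a ∈ M, G.Holds (letF a) t d → G.Holds nowF t d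
  succession : ∀ a ∈ M, ∀ b ∈ M, b.tgt ≠ a.src → G.Holds (letF a) t d →
    ¬ G.Holds (dia0 (and nxtF (dia1 (letF b)))) t d
  exists_event : ∀ a ∈ M, ∀ e ∈ eventsOf M, a.op.event = some e → G.Holds (letF a) t d →
    ∃ x ∈ G.D t, G.Holds (var e) t x ∧ ∀ y ∈ G.D t, G.Holds (var e) t y → y = x
  no_event : ∀ a ∈ M, ∀ e ∈ eventsOf M, a.op.event ≠ some e → G.Holds (letF a) t d →
    ∀ x ∈ G.D t, ¬ G.Holds (var e) t x
  fresh : ∀ a ∈ M, G.Holds (incF a.op.reg) t d → ¬ G.Holds (laterF (decF a.op.reg)) t d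
  added : ∀ a ∈ M, G.Holds (decF a.op.reg) t d → G.Holds (laterF (incF a.op.reg)) t d
  zero_test : ∀ a ∈ M, ∀ i, a.op = .zero i → G.Holds (letF a) t d →
    ∀ x ∈ G.D t, ¬ G.Holds (counterF i) t x

variable {G}

theorem holds_rulesF {M : List Transition} (hd : d ∈ G.D t) :
    G.Holds (rulesF M) t d ↔ G.Rules M t d := by
  have hev : ∀ a e, G.Holds (imp (letF a) (eventF a.op e)) t d ↔
      (a.op.event = some e → G.Holds (letF a) t d →
        ∃ x ∈ G.D t, G.Holds (var e) t x ∧ ∀ y ∈ G.D t, G.Holds (var e) t y → y = x) ∧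
      (a.op.event ≠ some e → G.Holds (letF a) t d → ∀ x ∈ G.D t, ¬ G.Holds (var e) t x) := by
    intro a e
    rw [holds_imp, eventF]
    split_ifs with h
    · simp [h, holds_uniq hd]
    · simp [h, holds_all hd, holds_neg]
  have hz : ∀ a : Transition, G.Holds (imp (letF a) (zeroTestF a.op)) t d ↔
      ∀ i, a.op = .zero i → G.Holds (letF a) t d →
        ∀ x ∈ G.D t, ¬ G.Holds (counterF i) t x := by
    intro a
    rw [holds_imp]
    rcases a.op with i | i | i
    · simp [zeroTestF, holds_verum]
    · simp [zeroTestF, holds_verum]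
    · simp only [zeroTestF, holds_all hd, holds_neg, CounterOp.zero.injEq]
      exact ⟨fun h j hj => hj ▸ h, fun h => h i rfl⟩
  have hs : ∀ a b : Transition, G.Holds (if b.tgt = a.src then neg falsum else
      neg (and (letF a) (dia0 (and nxtF (dia1 (letF b)))))) t d ↔
      (b.tgt ≠ a.src → G.Holds (letF a) t d →
        ¬ G.Holds (dia0 (and nxtF (dia1 (letF b)))) t d) := by
    intro a b
    split_ifs with h
    · simp [h, holds_verum]
    · rw [holds_neg, holds_and]; tauto
  rw [rulesF, holds_conj]
  simp only [List.forall_mem_cons, List.not_mem_nil, false_imp_iff, implies_true, and_true,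
    holds_conj, List.forall_mem_map, hev, hz, hs]
  simp only [holds_imp, holds_neg, holds_and, holds_all hd, holds_ex hd, holds_tickF, holds_disj,
    holds_onceF, List.mem_map, exists_exists_and_eq_and, not_and]
  constructor
  · rintro ⟨h1, h2, h3, h4, h5, h6, h7, h8, h9, h10, h11, h12, h13, h14, h15, h16, h17, h18, h19⟩
    exact ⟨Bool.rec h2 h1, Bool.rec (fun h h' => h3 h' h) h3, fun c hc => h4 ⟨c, hc⟩,
      fun c hc => h5 ⟨c, hc⟩, h6, h7, h8, h9, h10, h11, h12, h13, h14, h15,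
      fun a ha e he => (h16 a ha e he).1, fun a ha e he => (h16 a ha e he).2, h17, h18, h19⟩
  · intro h
    exact ⟨h.col_uniform true, h.col_uniform false, h.col_exclusive true,
      fun ⟨c, hc⟩ => h.exists_now c hc, fun ⟨c, hc⟩ => h.exists_nxt c hc, h.nxt_once, h.now_once,
      h.exists_letter, h.not_nxt_of_now, h.not_now_of_nxt, h.event_persist, h.event_once,
      h.letter_persist, h.now_of_letter, h.succession,
      fun a ha e he => ⟨h.exists_event a ha e he, h.no_event a ha e he⟩, h.fresh, h.added,
      h.zero_test⟩

theorem holds_linkF {c : Bool} : G.Holds (linkF c) t d ↔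
    G.Holds (colF !c) t d ∧
    (∃ u, G.R t u ∧ d ∈ G.D u ∧ G.Holds (colF c) u d ∧ G.Holds nxtF u d) ∧
    (∀ u, G.R t u → d ∈ G.D u → G.Holds nxtF u d → G.Holds (colF c) u d) ∧
    (∀ u, G.R t u → d ∈ G.D u → G.Holds (colF c) u d →
      G.Holds nxtF u d ∨ ¬ G.Holds (dia0 nxtF) u d) := by
  rw [linkF, holds_conj]
  simp only [List.forall_mem_cons, List.not_mem_nil, false_imp_iff, implies_true, and_true,
    holds_box0, holds_dia0, holds_imp, holds_or, holds_neg, holds_and]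

theorem holds_startF {M : List Transition} (hd : d ∈ G.D t) : G.Holds (startF M) t d ↔
    G.Holds nowF t d ∧ (∃ c, G.Holds (colF c) t d) ∧
    (∀ x ∈ G.D t, ¬ G.Holds (laterF (neg falsum)) t x) ∧
    (∀ a ∈ M, a.src ≠ 0 → ¬ G.Holds (letF a) t d) := by
  have hs : ∀ a : Transition, G.Holds (if a.src = 0 then neg falsum else neg (letF a)) t d ↔
      (a.src ≠ 0 → ¬ G.Holds (letF a) t d) := by
    intro a
    split_ifs with h
    · simp [h, holds_verum]
    · rw [holds_neg]; tauto
  rw [startF, holds_conj]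
  simp only [List.forall_mem_cons, List.not_mem_nil, false_imp_iff, implies_true, and_true,
    holds_conj, List.forall_mem_map, hs, holds_tickF, holds_all hd, holds_neg]

theorem holds_inputF {n : ℕ} (hd : d ∈ G.D t) : G.Holds (inputF n) t d ↔
    (G.Holds (letF .load) t d → ∀ x ∈ G.D t, ¬ G.Holds (depthF n) t x) ∧
    (G.Holds (letF .last) t d → ∃ x ∈ G.D t, G.Holds (depthF n) t x) := by
  simp only [inputF, holds_and, holds_imp, holds_all hd, holds_ex hd, holds_neg]

/-- By `hD` the column of the root contains all columns it sees, so `all` followed by `box0` reaches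
every point of them. -/
theorem holds_runF {M : List Transition} {n : ℕ} (hd : d ∈ G.D t)
    (hD : ∀ t', G.R t t' → G.D t' ⊆ G.D t) : G.Holds (runF M n) t d ↔
    (∀ u, G.R t u → ∀ x ∈ G.D u, G.Holds (inputF n) u x) ∧
    (∀ u, G.R t u → ∀ x ∈ G.D u, G.Rules M u x) ∧
    (∀ u, G.R t u → ∀ x ∈ G.D u, G.Holds nxtF u x →
      ∃ w, G.R t w ∧ x ∈ G.D w ∧ G.Holds nowF w x ∧ ∃ c, G.Holds (linkF c) w x) ∧
    (∃ u, G.R t u ∧ ∃ x ∈ G.D u, G.Holds (startF M) u x) := by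
  rw [runF, holds_and, holds_and, holds_and, holds_all hd, holds_all hd, holds_all hd, holds_ex hd]
  simp only [holds_box0, holds_imp, holds_dia0, holds_and, holds_or]
  refine and_congr ?_ (and_congr ?_ (and_congr ?_ ?_))
  · exact ⟨fun h u hu x hx => h x (hD u hu hx) u hu hx, fun h x _ u hu hx => h u hu x hx⟩
  · exact ⟨fun h u hu x hx => (holds_rulesF hx).1 (h x (hD u hu hx) u hu hx),
      fun h x _ u hu hx => (holds_rulesF hx).2 (h u hu x hx)⟩
  · constructor
    · intro h u hu x hx hn
      obtain ⟨w, h1, h2, h3, h4⟩ := h x (hD u hu hx) ⟨u, hu, hx, hn⟩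
      exact ⟨w, h1, h2, h3, h4.elim (fun h => ⟨_, h⟩) (fun h => ⟨_, h⟩)⟩
    · rintro h x - ⟨u, hu, hx, hn⟩
      obtain ⟨w, h1, h2, h3, c, h4⟩ := h u hu x hx hn
      refine ⟨w, h1, h2, h3, ?_⟩
      cases c
      · exact Or.inr h4
      · exact Or.inl h4
  · exact ⟨fun ⟨x, _, u, hu, hx, h⟩ => ⟨u, hu, x, hx, h⟩,
      fun ⟨u, hu, x, hx, h⟩ => ⟨x, hD u hu hx, u, hu, hx, h⟩⟩

end GridModel

/-! ### From a model to an infinite run -/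

namespace GridModel

open BiFormula

/-- The situation at the root `r` of a model of the reduction: a weak order, decreasing columns,
and the rules at all later points. -/
structure Ruled {T : Type u} {V : Type v} (G : GridModel T V) (M : List Transition) (r : T) :
    Prop where
  trans : ∀ x y z, G.R x y → G.R y z → G.R x z
  conn : ∀ x y z, G.R x y → G.R x z → y = z ∨ G.R y z ∨ G.R z y
  anti : ∀ x y, G.R x y → G.D y ⊆ G.D x
  rules : ∀ u, G.R r u → ∀ d ∈ G.D u, G.Rules M u d

variable {T : Type u} {V : Type v} {G : GridModel T V} {M : List Transition} {r : T}

/-- `u` and `x` belong to the same run of ticks of colour `c`, and `u` comes first. -/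
structure SameRun (G : GridModel T V) (c : Bool) (u x : T) : Prop where
  rel : G.R u x
  col_left : ∀ d ∈ G.D u, G.Holds (colF c) u d
  col_right : ∀ d ∈ G.D x, G.Holds (colF c) x d
  rel_of_col : ∀ w, G.R u w → ∀ d ∈ G.D w, G.Holds (colF !c) w d → G.R x w

/-- The ticks `x` and `x'` follow each other. -/
structure Consecutive (G : GridModel T V) (c : Bool) (x x' : T) (y : V) : Prop where
  rel : G.R x x'
  mem : y ∈ G.D x'
  col_left : G.Holds (colF !c) x y
  col_right : G.Holds (colF c) x' y
  nxt : G.Holds nxtF x' y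
  nxt_first : ∀ u, G.R x u → y ∈ G.D u → G.Holds (colF c) u y →
    G.Holds nxtF u y ∨ ¬ G.Holds (dia0 nxtF) u y

theorem laterF_mono {φ ψ : BiFormula} {t : T} {d : V}
    (h : ∀ u, G.R t u → d ∈ G.D u → G.Holds φ u d → G.Holds ψ u d)
    (htr : ∀ x y z, G.R x y → G.R y z → G.R x z)
    (hl : G.Holds (laterF φ) t d) : G.Holds (laterF ψ) t d := by
  rw [holds_laterF] at hl ⊢
  obtain ⟨c, hc, u, hu, hd, hcu, h1⟩ := hl
  refine ⟨c, hc, u, hu, hd, hcu, h1.imp (h u hu hd) ?_⟩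
  rintro ⟨w, h2, h3, h4⟩
  exact ⟨w, h2, h3, h w (htr _ _ _ hu h2) h3 h4⟩

namespace Ruled

variable (hG : G.Ruled M r)
include hG

theorem dia0_of_laterF {φ : BiFormula} {t : T} {d : V} (h : G.Holds (laterF φ) t d) :
    G.Holds (dia0 φ) t d := by
  rw [holds_laterF] at h
  obtain ⟨c, -, u, hu, hd, -, h1 | ⟨w, h2, h3, h4⟩⟩ := h
  · exact ⟨u, hu, hd, h1⟩
  · exact ⟨w, hG.trans _ _ _ hu h2, h3, h4⟩

/-- A tick of the other colour seen from `u` is also seen from `x`, and its elements lie in the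
column of `x` because columns decrease. -/
theorem laterF_of_sameRun {c : Bool} {u x : T} (hu : G.R r u) (hs : G.SameRun c u x)
    {φ : BiFormula} {d : V} (hd : d ∈ G.D u) (h : G.Holds (laterF φ) u d) :
    d ∈ G.D x ∧ G.Holds (laterF φ) x d := by
  rw [holds_laterF] at h
  obtain ⟨c', hc', w, hw, hdw, hcw, h1⟩ := h
  have hcc : c' = c := by
    by_contra hne
    have : c' = !c := by cases c <;> cases c' <;> simp_all
    exact (hG.rules u hu d hd).col_exclusive c (hs.col_left d hd) (this ▸ hc')
  subst hcc
  have hxw := hs.rel_of_col w hw d hdw hcw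
  have hdx := hG.anti _ _ hxw hdw
  exact ⟨hdx, holds_laterF.2 ⟨c', hs.col_right d hdx, w, hxw, hdw, hcw, h1⟩⟩

/-- Persistence puts the letter at `u` or beyond a tick of the other colour. In the second case the
element would be current at `x` and again later, against `now_once`. -/
theorem letter_of_sameRun {c : Bool} {u x : T} (hu : G.R r u) (hs : G.SameRun c u x)
    {a : Transition} (ha : a ∈ M) {z : V} (hz : z ∈ G.D x) (h : G.Holds (letF a) x z) :
    G.Holds (letF a) u z := by
  have hzu := hG.anti _ _ hs.rel hz
  have hx := hG.trans _ _ _ hu hs.rel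
  rcases holds_persistF.1 ((hG.rules u hu z hzu).letter_persist a ha) ⟨c, hs.col_left z hzu⟩
    ⟨x, hs.rel, hz, h⟩ with h1 | h1
  · exact h1
  · refine absurd ?_ ((hG.rules x hx z hz).now_once ((hG.rules x hx z hz).now_of_letter a ha h))
    exact laterF_mono (fun w hw hdw => (hG.rules w (hG.trans _ _ _ hx hw) z hdw).now_of_letter a ha)
      hG.trans (hG.laterF_of_sameRun hu hs hzu h1).2

theorem exists_letter {c : Bool} {x : T} (hx : G.R r x) {d : V} (hd : d ∈ G.D x)
    (hc : G.Holds (colF c) x d) : ∃ a ∈ M, ∃ z ∈ G.D x, G.Holds (letF a) x z := by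
  obtain ⟨z, hz, h1⟩ := (hG.rules x hx d hd).exists_now c hc
  obtain ⟨a, ha, h2⟩ := (hG.rules x hx z hz).exists_letter h1
  exact ⟨a, ha, z, hz, h2⟩

/-- Both points carry the same letter, so both columns have a unique element with the event, or none
has. The one at `x` also has the event at `u`, by persistence and `event_once`; uniqueness at `u`
identifies it with `d`, which puts `d` into the smaller column. -/
theorem event_of_sameRun {c : Bool} {u x : T} (hu : G.R r u) (hs : G.SameRun c u x)
    {y : V} (hy : y ∈ G.D x) {e : ℕ} (he : e ∈ eventsOf M) {d : V} (hd : d ∈ G.D u)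
    (h : G.Holds (var e) u d) : d ∈ G.D x ∧ G.Holds (var e) x d := by
  have hx := hG.trans _ _ _ hu hs.rel
  obtain ⟨a, ha, z, hz, h1⟩ := hG.exists_letter hx hy (hs.col_right y hy)
  have h2 := hG.letter_of_sameRun hu hs ha hz h1
  have hzu := hG.anti _ _ hs.rel hz
  by_cases hae : a.op.event = some e
  · obtain ⟨b, hb, h3, -⟩ := (hG.rules x hx z hz).exists_event a ha e he hae h1
    obtain ⟨b', hb', h4, h5⟩ := (hG.rules u hu z hzu).exists_event a ha e he hae h2
    have hbu := hG.anti _ _ hs.rel hb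
    have h6 : G.Holds (var e) u b := by
      rcases holds_persistF.1 ((hG.rules u hu b hbu).event_persist e he) ⟨c, hs.col_left b hbu⟩
        ⟨x, hs.rel, hb, h3⟩ with h6 | h6
      · exact h6
      · exact absurd (hG.laterF_of_sameRun hu hs hbu h6).2
          ((hG.rules x hx b hb).event_once e he h3)
    have : d = b := by rw [h5 d hd h, h5 b hbu h6]
    subst this
    exact ⟨hb, h3⟩
  · exact absurd h ((hG.rules u hu z hzu).no_event a ha e he hae h2 d hd)

/-- A tick of colour `c` before `x'` has the mark on `y`, by `nxt_first`. Beyond a tick of the other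
colour in between, the mark would recur at `x'`, against `nxt_once`. -/
theorem cases_of_consecutive {c : Bool} {x x' : T} {y : V} (hx : G.R r x)
    (h : G.Consecutive c x x' y) {u : T} (hu : G.R x u) {d : V} (hd : d ∈ G.D u)
    (hc : G.Holds (colF c) u d) : u = x' ∨ G.R x' u ∨ G.SameRun c u x' := by
  rcases hG.conn _ _ _ hu h.rel with h1 | h1 | h1
  · exact Or.inl h1
  swap
  · exact Or.inr (Or.inl h1)
  have hru := hG.trans _ _ _ hx hu
  have hrx' := hG.trans _ _ _ hx h.rel
  have hyu := hG.anti _ _ h1 h.mem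
  have hcu := (hG.rules u hru d hd).col_uniform c hc
  have hcx' := (hG.rules x' hrx' y h.mem).col_uniform c h.col_right
  have hnu : G.Holds nxtF u y := by
    rcases h.nxt_first u hu hyu (hcu y hyu) with h2 | h2
    · exact h2
    · exact absurd ⟨x', h1, h.mem, h.nxt⟩ h2
  refine Or.inr (Or.inr ⟨h1, hcu, hcx', fun w hw b hb hcw => ?_⟩)
  have hrw := hG.trans _ _ _ hru hw
  rcases hG.conn _ _ _ hw h1 with h2 | h2 | h2
  · subst h2
    exact absurd hcw ((hG.rules w hrw b hb).col_exclusive c (hcx' b hb))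
  · refine absurd ?_ ((hG.rules u hru y hyu).nxt_once hnu)
    exact holds_laterF.2 ⟨c, hcu y hyu, w, hw, hG.anti _ _ h2 h.mem,
      (hG.rules w hrw b hb).col_uniform _ hcw y (hG.anti _ _ h2 h.mem),
      Or.inr ⟨x', h2, h.mem, h.nxt⟩⟩
  · exact h2

/-- The witness passes through a tick of colour `c`, located by `cases_of_consecutive`. Only a tick
before `x'` in the same run can keep `φ` to itself; that case is settled separately for events and
for depth. -/
theorem laterF_of_consecutive {c : Bool} {x x' : T} {y : V} (hx : G.R r x)
    (h : G.Consecutive c x x' y) {φ : BiFormula}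
    (hφ : ∀ t d, G.R r t → d ∈ G.D t → G.Holds (persistF φ) t d) {d : V}
    (hd : d ∈ G.D x) (hl : G.Holds (laterF φ) x d) :
    (d ∈ G.D x' ∧ (G.Holds φ x' d ∨ G.Holds (laterF φ) x' d)) ∨
    ∃ u, G.R r u ∧ G.SameRun c u x' ∧ d ∈ G.D u ∧ G.Holds φ u d := by
  have hxy := hG.anti _ _ h.rel h.mem
  have hrx' := hG.trans _ _ _ hx h.rel
  rw [holds_laterF] at hl
  obtain ⟨c', hc', u, hu, hdu, hcu, h1⟩ := hl
  have hcc : (!c') = c := by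
    by_contra hne
    have h2 : c' = c := by cases c <;> cases c' <;> simp_all
    subst h2
    exact (hG.rules x hx d hd).col_exclusive c' hc'
      ((hG.rules x hx y hxy).col_uniform _ h.col_left d hd)
  rw [hcc] at hcu
  have hru := hG.trans _ _ _ hx hu
  have hcx' := (hG.rules x' hrx' y h.mem).col_uniform c h.col_right
  rcases hG.cases_of_consecutive hx h hu hdu hcu with h2 | h2 | h2
  · subst h2
    refine Or.inl ⟨hdu, h1.elim Or.inl fun h3 => ?_⟩
    exact holds_persistF.1 (hφ u d hru hdu) ⟨c, hcu⟩ h3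
  · have hdx' := hG.anti _ _ h2 hdu
    refine Or.inl ⟨hdx', ?_⟩
    refine holds_persistF.1 (hφ x' d hrx' hdx') ⟨c, hcx' d hdx'⟩ ?_
    rcases h1 with h1 | ⟨w, h3, h4, h5⟩
    · exact ⟨u, h2, hdu, h1⟩
    · exact ⟨w, hG.trans _ _ _ h2 h3, h4, h5⟩
  · rcases h1.elim Or.inl fun h3 => holds_persistF.1 (hφ u d hru hdu) ⟨c, hcu⟩ h3 with h3 | h3
    · exact Or.inr ⟨u, hru, h2, hdu, h3⟩
    · have := hG.laterF_of_sameRun hru h2 hdu h3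
      exact Or.inl ⟨this.1, Or.inr this.2⟩

theorem laterF_of_now_or_later {c : Bool} {x x' : T} {y : V} (hx : G.R r x)
    (h : G.Consecutive c x x' y) {φ : BiFormula} {d : V} (hd : d ∈ G.D x')
    (hl : G.Holds φ x' d ∨ G.Holds (laterF φ) x' d) : G.Holds (laterF φ) x d := by
  have hxy := hG.anti _ _ h.rel h.mem
  have hrx' := hG.trans _ _ _ hx h.rel
  refine holds_laterF.2 ⟨!c, (hG.rules x hx y hxy).col_uniform _ h.col_left d
    (hG.anti _ _ h.rel hd), x', h.rel, hd, ?_, hl.imp_right hG.dia0_of_laterF⟩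
  rw [Bool.not_not]
  exact (hG.rules x' hrx' y h.mem).col_uniform c h.col_right d hd

theorem laterF_event_iff {c : Bool} {x x' : T} {y : V} (hx : G.R r x)
    (h : G.Consecutive c x x' y) {e : ℕ} (he : e ∈ eventsOf M) {d : V} (hd : d ∈ G.D x) :
    G.Holds (laterF (var e)) x d ↔
      d ∈ G.D x' ∧ (G.Holds (var e) x' d ∨ G.Holds (laterF (var e)) x' d) := by
  refine ⟨fun hl => ?_, fun hl => hG.laterF_of_now_or_later hx h hl.1 hl.2⟩
  rcases hG.laterF_of_consecutive hx h
    (fun t d ht hd => (hG.rules t ht d hd).event_persist e he) hd hl with h1 | ⟨u, hu, h1, h2, h3⟩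
  · exact h1
  · have := hG.event_of_sameRun hu h1 h.mem he h2 h3
    exact ⟨this.1, Or.inl this.2⟩

/-- If the point where `laterF φ` holds has the colour of `t`, its own witness serves `t` as well;
if not, the point itself is the tick of the other colour. -/
theorem persistF_laterF (φ : BiFormula) (t : T) (d : V) :
    G.Holds (persistF (laterF φ)) t d := by
  rw [holds_persistF]
  rintro ⟨c, hc⟩ ⟨v, hv, hdv, h⟩
  have h' := h
  rw [holds_laterF] at h'
  obtain ⟨c', hc', w, hw, hdw, hcw, h1⟩ := h'
  by_cases hcc : c' = c
  · subst hcc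
    exact Or.inl (holds_laterF.2 ⟨c', hc, w, hG.trans _ _ _ hv hw, hdw, hcw, h1⟩)
  · have : c' = !c := by cases c <;> cases c' <;> simp_all
    exact Or.inr (holds_laterF.2 ⟨c, hc, v, hv, hdv, this ▸ hc', Or.inl h⟩)

/-- From depth 2 on, the formula inside the outer `laterF` is again a `laterF`, hence persistent and
transported along a run of one colour. Depths 0 and 1 need no descent. -/
theorem depthF_of_consecutive {c : Bool} {x x' : T} {y : V} (hx : G.R r x)
    (h : G.Consecutive c x x' y) {k : ℕ} {d : V} (hd : d ∈ G.D x)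
    (hl : G.Holds (depthF (k + 2)) x d) :
    d ∈ G.D x' ∧ (G.Holds (depthF (k + 1)) x' d ∨ G.Holds (depthF (k + 2)) x' d) := by
  rcases hG.laterF_of_consecutive hx h
    (fun t d _ _ => hG.persistF_laterF (depthF k) t d) hd hl with h1 | ⟨u, hu, h1, h2, h3⟩
  · exact h1
  · have := hG.laterF_of_sameRun hu h1 h2 h3
    exact ⟨this.1, Or.inl this.2⟩

/-- The mark at `x'` makes its element current at some `x` seen from the root. By weak connectedness
the two points are comparable, and the rules on `nowF` and `nxtF` leave only `x` before `x'`. -/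
theorem exists_consecutive
    (hnext : ∀ u, G.R r u → ∀ x ∈ G.D u, G.Holds nxtF u x →
      ∃ w, G.R r w ∧ x ∈ G.D w ∧ G.Holds nowF w x ∧ ∃ c, G.Holds (linkF c) w x)
    {x' : T} {y' : V} (hx' : G.R r x') (hy' : y' ∈ G.D x') {c : Bool}
    (hc : G.Holds (colF c) x' y') :
    ∃ x y, G.R r x ∧ y ∈ G.D x ∧ G.Holds nowF x y ∧ G.Consecutive c x x' y := by
  obtain ⟨y, hy, hn⟩ := (hG.rules x' hx' y' hy').exists_nxt c hc
  obtain ⟨x, hx, hyx, hnow, c', hl⟩ := hnext x' hx' y hy hn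
  obtain ⟨h1, -, h3, h4⟩ := holds_linkF.1 hl
  have hrel : G.R x x' := by
    rcases hG.conn _ _ _ hx hx' with h | h | h
    · subst h
      exact absurd hn ((hG.rules x hx y hy).not_nxt_of_now hnow)
    · exact h
    · exact absurd ⟨x, h, hyx, hnow⟩ ((hG.rules x' hx' y hy).not_now_of_nxt hn)
  have hcy := (hG.rules x' hx' y' hy').col_uniform c hc y hy
  have hcc : c' = c := by
    by_contra hne
    have : c' = !c := by cases c <;> cases c' <;> simp_all
    exact (hG.rules x' hx' y hy).col_exclusive c hcy (this ▸ h3 x' hrel hy hn)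
  subst hcc
  exact ⟨x, y, hx, hyx, hnow, hrel, hy, h1, hcy, hn, h4⟩

/-- The ticks of a model of the reduction. -/
theorem exists_ticks
    (hnext : ∀ u, G.R r u → ∀ x ∈ G.D u, G.Holds nxtF u x →
      ∃ w, G.R r w ∧ x ∈ G.D w ∧ G.Holds nowF w x ∧ ∃ c, G.Holds (linkF c) w x)
    {x₀ : T} {y₀ : V} (hx₀ : G.R r x₀) (hy₀ : y₀ ∈ G.D x₀) (hn₀ : G.Holds nowF x₀ y₀)
    (hc₀ : ∃ c, G.Holds (colF c) x₀ y₀) :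
    ∃ (x : ℕ → T) (y : ℕ → V) (c : ℕ → Bool), x 0 = x₀ ∧ y 0 = y₀ ∧
      ∀ m, G.R r (x m) ∧ y m ∈ G.D (x m) ∧ G.Holds nowF (x m) (y m) ∧
        G.Consecutive (c m) (x (m + 1)) (x m) (y (m + 1)) := by
  let S := {p : T × V × Bool // G.R r p.1 ∧ p.2.1 ∈ G.D p.1 ∧ G.Holds nowF p.1 p.2.1 ∧
    G.Holds (colF p.2.2) p.1 p.2.1}
  have step : ∀ p : S, ∃ q : S, G.Consecutive p.1.2.2 q.1.1 p.1.1 q.1.2.1 := by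
    rintro ⟨⟨x, y, c⟩, h1, h2, h3, h4⟩
    obtain ⟨x', y', h5, h6, h7, h8⟩ := hG.exists_consecutive hnext h1 h2 h4
    exact ⟨⟨⟨x', y', !c⟩, h5, h6, h7, h8.col_left⟩, h8⟩
  choose f hf using step
  obtain ⟨c₀, hc₀⟩ := hc₀
  let s : ℕ → S := fun m => f^[m] ⟨⟨x₀, y₀, c₀⟩, hx₀, hy₀, hn₀, hc₀⟩
  refine ⟨fun m => (s m).1.1, fun m => (s m).1.2.1, fun m => (s m).1.2.2, rfl, rfl, fun m =>
    ⟨(s m).2.1, (s m).2.2.1, (s m).2.2.2.1, ?_⟩⟩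
  have := hf (s m)
  simp only [s, Function.iterate_succ_apply'] at this ⊢
  exact this

end Ruled

theorem mem_eventsOf_inc {a : Transition} (ha : a ∈ M) : 4 * a.op.reg ∈ eventsOf M :=
  List.mem_flatMap.2 ⟨a, ha, by simp⟩

theorem mem_eventsOf_dec {a : Transition} (ha : a ∈ M) : 4 * a.op.reg + 1 ∈ eventsOf M :=
  List.mem_flatMap.2 ⟨a, ha, by simp⟩

/-- The elements of counter `i` at the moment `t`. -/
def counterSet (G : GridModel T V) (t : T) (i : ℕ) : Set V :=
  {d | d ∈ G.D t ∧ G.Holds (counterF i) t d}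

theorem Ruled.counterSet_of_consecutive (hG : G.Ruled M r) {c : Bool} {x x' : T} {y : V}
    (hx : G.R r x) (h : G.Consecutive c x x' y) {i : ℕ} (hi : ∃ a ∈ M, a.op.reg = i) :
    G.counterSet x i = {d | d ∈ G.D x' ∧
      (G.Holds (incF i) x' d ∨ G.Holds (laterF (incF i)) x' d) ∧
      ¬ (G.Holds (decF i) x' d ∨ G.Holds (laterF (decF i)) x' d)} := by
  obtain ⟨a, ha, rfl⟩ := hi
  ext d
  simp only [counterSet, counterF, holds_and, holds_neg, Set.mem_ofPred_eq]
  constructor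
  · rintro ⟨h1, h2, h3⟩
    have h4 := (hG.laterF_event_iff hx h (mem_eventsOf_inc ha) h1).1 h2
    exact ⟨h4.1, h4.2, fun h5 => h3 ((hG.laterF_event_iff hx h (mem_eventsOf_dec ha) h1).2
      ⟨h4.1, h5⟩)⟩
  · rintro ⟨h1, h2, h3⟩
    have h4 := hG.anti _ _ h.rel h1
    exact ⟨h4, (hG.laterF_event_iff hx h (mem_eventsOf_inc ha) h4).2 ⟨h1, h2⟩, fun h5 =>
      h3 ((hG.laterF_event_iff hx h (mem_eventsOf_dec ha) h4).1 h5).2⟩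

open Classical in
/-- The value of counter `i` at the moment `t`. -/
noncomputable def counterVal (M : List Transition) (G : GridModel T V) (t : T) (i : ℕ) : ℕ :=
  -- Registers that no transition mentions keep the value 0. Since `ncard` is 0 on infinite sets,
  -- finiteness has to be carried along the run.
  if ∃ a ∈ M, a.op.reg = i then (G.counterSet t i).ncard else 0

/-- Membership at `x` differs from membership at `x'` only by the events at `x'`. `event_once` and
`fresh` make an added element really new, `event_once` and `added` make a removed one really
present. -/
theorem Ruled.counterSet_step (hG : G.Ruled M r) {c : Bool} {x x' : T} {y z : V}
    (hx : G.R r x) (h : G.Consecutive c x x' y) {a : Transition} (ha : a ∈ M) (hz : z ∈ G.D x')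
    (hl : G.Holds (letF a) x' z) {i : ℕ} (hi : ∃ a ∈ M, a.op.reg = i) :
    (a.op = .inc i → ∃ d ∉ G.counterSet x' i, G.counterSet x i = insert d (G.counterSet x' i)) ∧
    (a.op = .dec i → ∃ d ∈ G.counterSet x' i, G.counterSet x i = G.counterSet x' i \ {d}) ∧
    (a.op ≠ .inc i → a.op ≠ .dec i → G.counterSet x i = G.counterSet x' i) := by
  have hx' := hG.trans _ _ _ hx h.rel
  have hR := hG.rules x' hx' z hz
  have hset := hG.counterSet_of_consecutive hx h hi
  obtain ⟨b, hb, rfl⟩ := hi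
  have hno_inc : a.op ≠ .inc b.op.reg → ∀ d ∈ G.D x', ¬ G.Holds (incF b.op.reg) x' d := by
    intro hne d hd
    refine hR.no_event a ha _ (mem_eventsOf_inc hb) ?_ hl d hd
    intro he
    apply hne
    cases hop : a.op <;> simp only [hop, CounterOp.event, Option.some.injEq, reduceCtorEq] at he
    · congr 1; omega
    · omega
  have hno_dec : a.op ≠ .dec b.op.reg → ∀ d ∈ G.D x', ¬ G.Holds (decF b.op.reg) x' d := by
    intro hne d hd
    refine hR.no_event a ha _ (mem_eventsOf_dec hb) ?_ hl d hd
    intro he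
    apply hne
    cases hop : a.op <;> simp only [hop, CounterOp.event, Option.some.injEq, reduceCtorEq] at he
    · omega
    · congr 1; omega
  refine ⟨fun hop => ?_, fun hop => ?_, fun hop hop' => ?_⟩
  · obtain ⟨d, hd, h1, h2⟩ := hR.exists_event a ha _ (mem_eventsOf_inc hb)
      (by rw [hop]; rfl) hl
    have hRd := hG.rules x' hx' d hd
    have h3 := hno_dec (by rw [hop]; simp)
    have h4 := hRd.event_once _ (mem_eventsOf_inc hb) h1
    have h5 := hRd.fresh b hb h1
    refine ⟨d, fun hmem => h4 hmem.2.1, ?_⟩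
    rw [hset]
    ext w
    simp only [counterSet, counterF, holds_and, holds_neg, Set.mem_ofPred_eq, Set.mem_insert_iff]
    constructor
    · rintro ⟨h6, h7 | h7, h8⟩
      · exact Or.inl (h2 w h6 h7)
      · exact Or.inr ⟨h6, h7, fun h9 => h8 (Or.inr h9)⟩
    · rintro (rfl | ⟨h6, h7, h8⟩)
      · exact ⟨hd, Or.inl h1, fun h6 => h6.elim (h3 _ hd) h5⟩
      · exact ⟨h6, Or.inr h7, fun h9 => h9.elim (h3 w h6) h8⟩
  · obtain ⟨d, hd, h1, h2⟩ := hR.exists_event a ha _ (mem_eventsOf_dec hb)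
      (by rw [hop]; rfl) hl
    have hRd := hG.rules x' hx' d hd
    have h3 := hno_inc (by rw [hop]; simp)
    have h4 := hRd.event_once _ (mem_eventsOf_dec hb) h1
    have h5 := hRd.added b hb h1
    refine ⟨d, ⟨hd, h5, h4⟩, ?_⟩
    rw [hset]
    ext w
    simp only [counterSet, counterF, holds_and, holds_neg, Set.mem_ofPred_eq, Set.mem_sdiff,
      Set.mem_singleton_iff]
    constructor
    · rintro ⟨h6, h7 | h7, h8⟩
      · exact absurd h7 (h3 w h6)
      · exact ⟨⟨h6, h7, fun h9 => h8 (Or.inr h9)⟩, fun h9 => h8 (Or.inl (h9 ▸ h1))⟩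
    · rintro ⟨⟨h6, h7, h8⟩, h9⟩
      exact ⟨h6, Or.inr h7, fun h10 => h10.elim (fun h11 => h9 (h2 w h6 h11)) h8⟩
  · have h3 := hno_inc hop
    have h4 := hno_dec hop'
    rw [hset]
    ext w
    simp only [counterSet, counterF, holds_and, holds_neg, Set.mem_ofPred_eq]
    constructor
    · rintro ⟨h6, h7 | h7, h8⟩
      · exact absurd h7 (h3 w h6)
      · exact ⟨h6, h7, fun h9 => h8 (Or.inr h9)⟩
    · rintro ⟨h6, h7, h8⟩
      exact ⟨h6, Or.inr h7, fun h9 => h9.elim (h4 w h6) h8⟩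

/-- The counter values change as prescribed by the current transition. -/
theorem Ruled.rel_counterVal (hG : G.Ruled M r) {c : Bool} {x x' : T} {y z : V}
    (hx : G.R r x) (h : G.Consecutive c x x' y) {a : Transition} (ha : a ∈ M) (hz : z ∈ G.D x')
    (hl : G.Holds (letF a) x' z)
    (hfin : ∀ i, (∃ a ∈ M, a.op.reg = i) → (G.counterSet x' i).Finite) :
    a.op.Rel (counterVal M G x') (counterVal M G x) := by
  have hstep := fun i (hi : ∃ a ∈ M, a.op.reg = i) => hG.counterSet_step hx h ha hz hl hi
  have hother : ∀ j, a.op ≠ .inc j → a.op ≠ .dec j →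
      counterVal M G x j = counterVal M G x' j := by
    intro j h1 h2
    unfold counterVal
    split_ifs with hj
    · rw [(hstep j hj).2.2 h1 h2]
    · rfl
  have hreg : ∃ b ∈ M, b.op.reg = a.op.reg := ⟨a, ha, rfl⟩
  cases hop : a.op with
  | inc i =>
    rw [hop] at hreg
    obtain ⟨d, hd, h1⟩ := (hstep i hreg).1 hop
    funext j
    by_cases hj : j = i
    · subst hj
      rw [Function.update_self]
      simp only [counterVal, if_pos (show ∃ b ∈ M, b.op.reg = j from hreg)]
      rw [h1, Set.ncard_insert_of_notMem hd (hfin j hreg)]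
    · rw [Function.update_of_ne hj]
      exact hother j (by rw [hop]; simpa using Ne.symm hj) (by rw [hop]; simp)
  | dec i =>
    rw [hop] at hreg
    obtain ⟨d, hd, h1⟩ := (hstep i hreg).2.1 hop
    have h2 : counterVal M G x i + 1 = counterVal M G x' i := by
      simp only [counterVal, if_pos (show ∃ b ∈ M, b.op.reg = i from hreg)]
      rw [h1, Set.ncard_sdiff_singleton_add_one hd (hfin i hreg)]
    refine ⟨by omega, ?_⟩
    funext j
    by_cases hj : j = i
    · subst hj
      rw [Function.update_self]
      omega
    · rw [Function.update_of_ne hj]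
      exact hother j (by rw [hop]; simp) (by rw [hop]; simpa using Ne.symm hj)
  | zero i =>
    refine ⟨?_, ?_⟩
    · rw [hop] at hreg
      simp only [counterVal, if_pos (show ∃ b ∈ M, b.op.reg = i from hreg)]
      have h1 := (hG.rules x' (hG.trans _ _ _ hx h.rel) z hz).zero_test a ha i hop hl
      rw [show G.counterSet x' i = ∅ from Set.eq_empty_of_forall_notMem fun d hd => h1 d hd.1 hd.2]
      exact Set.ncard_empty V
    · funext j
      exact hother j (by rw [hop]; simp) (by rw [hop]; simp)

/-- A model of the reduction yields an infinite run. -/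
theorem hasRun_of_holds {n : ℕ} {d : V}
    (htr : ∀ x y z, G.R x y → G.R y z → G.R x z)
    (hconn : ∀ x y z, G.R x y → G.R x z → y = z ∨ G.R y z ∨ G.R z y)
    (hanti : ∀ x y, G.R x y → G.D y ⊆ G.D x) (hd : d ∈ G.D r)
    (h : G.Holds (runF (.load :: .last :: M) n) r d) : HasRun M n := by
  obtain ⟨hin, hrules, hnext, x₀, hx₀, y₀, hy₀, hstart⟩ := (holds_runF hd (hanti r)).1 h
  obtain ⟨hnow₀, hc₀, hend, hsrc⟩ := (holds_startF hy₀).1 hstart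
  have hG : G.Ruled (.load :: .last :: M) r := ⟨htr, hconn, hanti, hrules⟩
  obtain ⟨x, y, c, rfl, rfl, hx⟩ := hG.exists_ticks hnext hx₀ hy₀ hnow₀ hc₀
  have hlet : ∀ m, ∃ a ∈ Transition.load :: Transition.last :: M, G.Holds (letF a) (x m) (y m) :=
    fun m => (hG.rules _ (hx m).1 _ (hx m).2.1).exists_letter (hx m).2.2.1
  choose t ht hty using hlet
  have hend' : ∀ φ, ∀ w ∈ G.D (x 0), ¬ G.Holds (laterF φ) (x 0) w := fun φ w hw hl =>
    hend w hw (laterF_mono (fun _ _ _ _ => holds_verum) htr hl)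
  have hfin : ∀ m i, (∃ a ∈ Transition.load :: Transition.last :: M, a.op.reg = i) →
      (G.counterSet (x m) i).Finite := by
    intro m
    induction m with
    | zero =>
      intro i _
      rw [show G.counterSet (x 0) i = ∅ from Set.eq_empty_of_forall_notMem fun w hw =>
        hend' _ w hw.1 hw.2.1]
      exact Set.finite_empty
    | succ m ih =>
      intro i hi
      obtain ⟨h1, h2, h3⟩ := hG.counterSet_step (hx (m + 1)).1 (hx m).2.2.2 (ht m) (hx m).2.1
        (hty m) hi
      by_cases ho : (t m).op = .inc i
      · obtain ⟨b, -, hb⟩ := h1 ho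
        rw [hb]
        exact (ih i hi).insert b
      by_cases ho' : (t m).op = .dec i
      · obtain ⟨b, -, hb⟩ := h2 ho'
        rw [hb]
        exact (ih i hi).sdiff
      · rw [h3 ho ho']
        exact ih i hi
  -- Depth measures the number of steps: at most `m` at step `m`, and `m` is attained at `y 0`,
  -- which belongs to all columns `G.D (x m)`.
  have hdepth : ∀ m k w, w ∈ G.D (x m) → G.Holds (depthF k) (x m) w → k ≤ m := by
    intro m
    induction m with
    | zero =>
      intro k w hw hk
      cases k with
      | zero => exact le_rfl
      | succ k => exact absurd hk (hend' _ w hw)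
    | succ m ih =>
      intro k w hw hk
      rcases k with _ | _ | k
      · omega
      · omega
      · obtain ⟨h1, h2⟩ := hG.depthF_of_consecutive (hx (m + 1)).1 (hx m).2.2.2 hw hk
        rcases h2 with h2 | h2
        · have := ih _ w h1 h2; omega
        · have := ih _ w h1 h2; omega
  have hmem : ∀ m, y 0 ∈ G.D (x m) := by
    intro m
    induction m with
    | zero => exact hy₀
    | succ m ih => exact hanti _ _ (hx m).2.2.2.rel ih
  have htick : ∀ m, G.Holds (depthF 0) (x m) (y 0) := fun m => holds_tickF.2 ⟨c m,
    (hG.rules _ (hx m).1 _ (hx m).2.2.2.mem).col_uniform _ (hx m).2.2.2.col_right _ (hmem m)⟩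
  have hdepth' : ∀ m k, k ≤ m → G.Holds (depthF k) (x m) (y 0) := by
    intro m
    induction m with
    | zero => intro k hk; rw [Nat.le_zero.1 hk]; exact htick 0
    | succ m ih =>
      intro k hk
      cases k with
      | zero => exact htick _
      | succ k =>
        exact hG.laterF_of_now_or_later (hx (m + 1)).1 (hx m).2.2.2 (hmem m)
          (Or.inl (ih k (by omega)))
  have hinput := fun m => (holds_inputF (hx m).2.1).1 (hin _ (hx m).1 _ (hx m).2.1)
  refine ⟨t, fun m => counterVal (.load :: .last :: M) G (x m), ht, ?_, ?_, fun m => ?_,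
    fun m => ?_, fun m hm => ?_, fun m hm => ?_⟩
  · by_contra h0
    exact hsrc _ (ht 0) h0 (hty 0)
  · funext i
    change counterVal _ G (x 0) i = 0
    unfold counterVal
    split_ifs
    · rw [show G.counterSet (x 0) i = ∅ from Set.eq_empty_of_forall_notMem fun w hw =>
        hend' _ w hw.1 hw.2.1]
      exact Set.ncard_empty V
    · rfl
  · by_contra hne
    have hcons := (hx m).2.2.2
    refine (hG.rules _ (hx (m + 1)).1 _ (hx (m + 1)).2.1).succession _ (ht (m + 1)) _ (ht m) hne
      (hty (m + 1)) ⟨x m, hcons.rel, hcons.mem, hcons.nxt, y m, (hx m).2.1, ?_, hty m⟩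
    -- `dia1` sees only other elements, so the current element must differ from the marked one.
    intro heq
    exact (hG.rules _ (hx m).1 _ (hx m).2.1).not_nxt_of_now (hx m).2.2.1 (heq ▸ hcons.nxt)
  · exact hG.rel_counterVal (hx (m + 1)).1 (hx m).2.2.2 (ht m) (hx m).2.1 (hty m) (hfin m)
  · by_contra hmn
    exact (hinput m).1 (hm ▸ hty m) _ (hmem m) (hdepth' m n (by omega))
  · obtain ⟨w, hw, h1⟩ := (hinput m).2 (hm ▸ hty m)
    exact hdepth m n w hw h1

end GridModel

/-! ### From an infinite run to a model -/

/-- The elements of the counters along a run: the `m`-th action adds `m`, or removes the least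
element. -/
noncomputable def counterElements (t : ℕ → Transition) : ℕ → ℕ → Finset ℕ
  | 0, _ => ∅
  | m + 1, i =>
    match (t m).op with
    | .inc j => if i = j then insert m (counterElements t m i) else counterElements t m i
    | .dec j => if i = j then (counterElements t m i).erase
        (sInf (counterElements t m i : Set ℕ)) else counterElements t m i
    | .zero _ => counterElements t m i

/-- Element `k` is added to counter `i` at step `m`. -/
def AddedAt (t : ℕ → Transition) (i m k : ℕ) : Prop := (t m).op = .inc i ∧ k = m

/-- Element `k` is removed from counter `i` at step `m`. -/
def RemovedAt (t : ℕ → Transition) (i m k : ℕ) : Prop :=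
  (t m).op = .dec i ∧ k = sInf (counterElements t m i : Set ℕ)

theorem mem_counterElements_succ (t : ℕ → Transition) (m i k : ℕ) :
    k ∈ counterElements t (m + 1) i ↔
      (k ∈ counterElements t m i ∨ AddedAt t i m k) ∧ ¬ RemovedAt t i m k := by
  rw [counterElements]
  unfold AddedAt RemovedAt
  rcases (t m).op with j | j | j
  · by_cases h : i = j
    · subst h
      simp [or_comm]
    · simp [h, Ne.symm h]
  · by_cases h : i = j
    · subst h
      simp [and_comm]
    · simp [h, Ne.symm h]
  · simp

theorem lt_of_mem_counterElements (t : ℕ → Transition) {m i k : ℕ}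
    (h : k ∈ counterElements t m i) : k < m := by
  induction m with
  | zero => simp [counterElements] at h
  | succ m ih =>
    rcases ((mem_counterElements_succ t m i k).1 h).1 with h | h
    · exact (ih h).trans (Nat.lt_succ_self m)
    · rw [h.2]; exact Nat.lt_succ_self m

section

variable {t : ℕ → Transition} {s : ℕ → ℕ → ℕ} (hs0 : s 0 = fun _ => 0)
  (hrel : ∀ m, (t m).op.Rel (s m) (s (m + 1)))
include hs0 hrel

theorem card_counterElements (m i : ℕ) : (counterElements t m i).card = s m i := by
  induction m with
  | zero => simp [counterElements, hs0]
  | succ m ih =>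
    have h := hrel m
    rw [counterElements]
    generalize (t m).op = o at h ⊢
    rcases o with j | j | j
    · rw [show s (m + 1) = _ from h]
      by_cases hij : i = j
      · subst hij
        simp [Finset.card_insert_of_notMem
          fun h => lt_irrefl m (lt_of_mem_counterElements t h), ih]
      · simp [hij, ih]
    · obtain ⟨h1, h2⟩ := h
      rw [h2]
      by_cases hij : i = j
      · subst hij
        have : sInf (counterElements t m i : Set ℕ) ∈ counterElements t m i :=
          Nat.sInf_mem (s := (counterElements t m i : Set ℕ))
            (Finset.coe_nonempty.2 (Finset.card_pos.1 (by omega)))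
        simp [Finset.card_erase_of_mem this, ih]
      · simp [hij, ih]
    · rw [h.2]
      exact ih

theorem mem_of_removedAt {i m k : ℕ} (h : RemovedAt t i m k) : k ∈ counterElements t m i := by
  have h1 := hrel m
  rw [h.1] at h1
  have h2 := card_counterElements hs0 hrel m i
  rw [h.2]
  exact Nat.sInf_mem (s := (counterElements t m i : Set ℕ))
    (Finset.coe_nonempty.2 (Finset.card_pos.1 (by have := h1.1; omega)))

/-- Passes from the recursion to the past events used in `counterF`. No element returns after its
removal: step `m` can only add `m`, and all elements removed earlier are smaller. -/
theorem mem_counterElements_iff (m i k : ℕ) :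
    k ∈ counterElements t m i ↔
      (∃ m' < m, AddedAt t i m' k) ∧ ¬ ∃ m' < m, RemovedAt t i m' k := by
  induction m with
  | zero => simp [counterElements]
  | succ m ih =>
    have split : ∀ p : ℕ → Prop, (∃ m' < m + 1, p m') ↔ (∃ m' < m, p m') ∨ p m := fun p => by
      constructor
      · rintro ⟨m', h1, h2⟩
        rcases Nat.lt_succ_iff_lt_or_eq.1 h1 with h | rfl
        exacts [Or.inl ⟨m', h, h2⟩, Or.inr h2]
      · rintro (⟨m', h1, h2⟩ | h)
        exacts [⟨m', by omega, h2⟩, ⟨m, by omega, h⟩]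
    rw [mem_counterElements_succ, ih, split, split]
    constructor
    · rintro ⟨⟨h1, h2⟩ | h1, h3⟩
      · exact ⟨Or.inl h1, fun h => h.elim h2 h3⟩
      · refine ⟨Or.inr h1, fun h => h.elim (fun ⟨m', h4, h5⟩ => ?_) h3⟩
        have := lt_of_mem_counterElements t (mem_of_removedAt hs0 hrel h5)
        have := h1.2
        omega
    · rintro ⟨h1 | h1, h2⟩
      · exact ⟨Or.inl ⟨h1, fun h => h2 (Or.inl h)⟩, fun h => h2 (Or.inr h)⟩
      · exact ⟨Or.inr h1, fun h => h2 (Or.inr h)⟩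

end

/-- The valuation that describes a run; `m` is a step and `k` an element. -/
def runVal (t : ℕ → Transition) (p m k : ℕ) : Prop :=
  -- Residues 0, 1, 2 modulo 4 encode additions, removals and transitions; 3 and 7 are the colours,
  -- 11 and 15 the marks for the next and the current element. The last case also catches the unused
  -- variables.
  if p % 4 = 0 then AddedAt t (p / 4) m k
  else if p % 4 = 1 then RemovedAt t (p / 4) m k
  else if p % 4 = 2 then (t m).code = p / 4 ∧ k = m
  else if p = 3 then m % 2 = 0
  else if p = 7 then m % 2 = 1
  else if p = 11 then k = m + 1
  else k = m

namespace GridModel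

open BiFormula

variable {T : Type u} {V : Type v}

/-- The model with constant columns that describes a run on the points of a sequence `x`. -/
def ofRun (R : T → T → Prop) (x : ℕ → T) (e : V ≃ ℕ) (t : ℕ → Transition) : GridModel T V where
  R := R
  D _ := Set.univ
  val p u d := ∃ m, u = x m ∧ runVal t p m (e d)

variable {R : T → T → Prop} {x : ℕ → T} {e : V ≃ ℕ} {t : ℕ → Transition}

/-- `φ` is true only on the points of the sequence `x`. -/
def Supported (G : GridModel T V) (x : ℕ → T) (φ : BiFormula) : Prop :=
  ∀ u d, G.Holds φ u d → ∃ m, u = x m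

theorem supported_var (p : ℕ) : (ofRun R x e t).Supported x (var p) :=
  fun _ _ ⟨m, hm, _⟩ => ⟨m, hm⟩

theorem supported_tickF : (ofRun R x e t).Supported x tickF := by
  intro u d h
  obtain ⟨c, hc⟩ := holds_tickF.1 h
  exact supported_var _ u d hc

theorem supported_laterF (φ : BiFormula) : (ofRun R x e t).Supported x (laterF φ) := by
  intro u d h
  obtain ⟨c, hc, -⟩ := holds_laterF.1 h
  exact supported_var _ u d hc

theorem Supported.and_left {G : GridModel T V} {φ : BiFormula} (h : G.Supported x φ)
    (ψ : BiFormula) : G.Supported x (.and φ ψ) :=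
  fun u d hu => h u d hu.1

theorem le_of_rel_ofRun {m m' : ℕ}
    (hR : ∀ n m, n ≠ m → (R (x n) (x m) ↔ m < n)) (h : R (x m) (x m')) : m' ≤ m := by
  by_contra hlt
  have := (hR m m' (by omega)).1 h
  omega

theorem dia0_ofRun (hR : ∀ n m, n ≠ m → (R (x n) (x m) ↔ m < n))
    {φ : BiFormula} {m m' : ℕ} {d : V} (hm : m' < m)
    (h : (ofRun R x e t).Holds φ (x m') d) : (ofRun R x e t).Holds (dia0 φ) (x m) d :=
  ⟨x m', (hR m m' (by omega)).2 hm, Set.mem_univ _, h⟩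

theorem exists_of_dia0_ofRun (hR : ∀ n m, n ≠ m → (R (x n) (x m) ↔ m < n))
    {φ : BiFormula} (hφ : (ofRun R x e t).Supported x φ) {m : ℕ} {d : V}
    (h : (ofRun R x e t).Holds (dia0 φ) (x m) d) :
    ∃ m' ≤ m, (ofRun R x e t).Holds φ (x m') d := by
  obtain ⟨u, hu, -, h1⟩ := h
  obtain ⟨m', rfl⟩ := hφ u d h1
  exact ⟨m', le_of_rel_ofRun hR hu, h1⟩

section

variable (hx : Function.Injective x)
include hx

theorem holds_var_ofRun {p m : ℕ} {d : V} :
    (ofRun R x e t).Holds (var p) (x m) d ↔ runVal t p m (e d) :=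
  ⟨fun ⟨_, h1, h2⟩ => hx h1 ▸ h2, fun h => ⟨m, rfl, h⟩⟩

theorem holds_colF_ofRun {c : Bool} {m : ℕ} {d : V} :
    (ofRun R x e t).Holds (colF c) (x m) d ↔ m % 2 = bif c then 0 else 1 := by
  rw [colF, holds_var_ofRun hx]
  cases c <;> simp [runVal]

theorem holds_nxtF_ofRun {m : ℕ} {d : V} :
    (ofRun R x e t).Holds nxtF (x m) d ↔ e d = m + 1 := by
  rw [nxtF, holds_var_ofRun hx]
  simp [runVal]

theorem holds_nowF_ofRun {m : ℕ} {d : V} :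
    (ofRun R x e t).Holds nowF (x m) d ↔ e d = m := by
  rw [nowF, holds_var_ofRun hx]
  simp [runVal]

theorem holds_letF_ofRun {a : Transition} {m : ℕ} {d : V} :
    (ofRun R x e t).Holds (letF a) (x m) d ↔ t m = a ∧ e d = m := by
  rw [letF, holds_var_ofRun hx, ← Transition.code_injective.eq_iff (a := t m)]
  simp only [runVal]
  rw [if_neg (by omega), if_neg (by omega), if_pos (by omega),
    show (4 * a.code + 2) / 4 = a.code by omega]

theorem holds_incF_ofRun {i m : ℕ} {d : V} :
    (ofRun R x e t).Holds (var (4 * i)) (x m) d ↔ AddedAt t i m (e d) := by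
  rw [holds_var_ofRun hx, runVal, if_pos (by omega), show 4 * i / 4 = i by omega]

theorem holds_decF_ofRun {i m : ℕ} {d : V} :
    (ofRun R x e t).Holds (var (4 * i + 1)) (x m) d ↔ RemovedAt t i m (e d) := by
  rw [holds_var_ofRun hx, runVal, if_neg (by omega), if_pos (by omega),
    show (4 * i + 1) / 4 = i by omega]

variable (hR : ∀ n m, n ≠ m → (R (x n) (x m) ↔ m < n))
include hR

/-- Colours alternate with parity, so `x (m - 1)` is a tick of the other colour from which all
earlier steps are seen. A possible loop at `x m` is harmless, as it does not change the colour. -/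
theorem holds_laterF_ofRun {φ : BiFormula} (hφ : (ofRun R x e t).Supported x φ) {m : ℕ} {d : V} :
    (ofRun R x e t).Holds (laterF φ) (x m) d ↔ ∃ m' < m, (ofRun R x e t).Holds φ (x m') d := by
  rw [holds_laterF]
  constructor
  · rintro ⟨c, hc, u, hu, -, hcu, h⟩
    obtain ⟨m', rfl⟩ := supported_var _ u d hcu
    rw [holds_colF_ofRun hx] at hc hcu
    have h1 := le_of_rel_ofRun hR hu
    have h2 : m' ≠ m := by
      rintro rfl
      cases c <;> simp at hc hcu <;> omega
    rcases h with h | h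
    · exact ⟨m', by omega, h⟩
    · obtain ⟨m'', h3, h4⟩ := exists_of_dia0_ofRun hR hφ h
      exact ⟨m'', by omega, h4⟩
  · rintro ⟨m', h1, h2⟩
    obtain ⟨n, rfl⟩ : ∃ n, m = n + 1 := ⟨m - 1, by omega⟩
    obtain ⟨c, hc⟩ : ∃ c, (n + 1) % 2 = bif c then 0 else 1 := by
      rcases Nat.mod_two_eq_zero_or_one (n + 1) with h | h
      · exact ⟨true, h⟩
      · exact ⟨false, h⟩
    refine ⟨c, (holds_colF_ofRun hx).2 hc, x n, (hR _ _ (by omega)).2 (by omega), Set.mem_univ _,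
      (holds_colF_ofRun hx).2 ?_, ?_⟩
    · cases c <;> simp at hc ⊢ <;> omega
    · by_cases hmn : m' = n
      · subst hmn; exact Or.inl h2
      · exact Or.inr (dia0_ofRun hR (by omega) h2)

theorem persistF_ofRun {φ : BiFormula} (hφ : (ofRun R x e t).Supported x φ) (u : T) (d : V) :
    (ofRun R x e t).Holds (persistF φ) u d := by
  rw [holds_persistF]
  rintro ⟨c, hc⟩ h
  obtain ⟨m, rfl⟩ := supported_var _ u d hc
  obtain ⟨m', h1, h2⟩ := exists_of_dia0_ofRun hR hφ h
  rw [holds_laterF_ofRun hx hR hφ]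
  by_cases hm : m' = m
  · exact Or.inl (hm ▸ h2)
  · exact Or.inr ⟨m', by omega, h2⟩

theorem holds_depthF_ofRun {k m : ℕ} {d : V} :
    (ofRun R x e t).Holds (depthF k) (x m) d ↔ k ≤ m := by
  have hsupp : ∀ k, (ofRun R x e t).Supported x (depthF k) := fun k => by
    cases k
    exacts [supported_tickF, supported_laterF _]
  induction k generalizing m with
  | zero =>
    simp only [depthF, holds_tickF, holds_colF_ofRun hx, Nat.zero_le, iff_true]
    rcases Nat.mod_two_eq_zero_or_one m with h | h
    · exact ⟨true, h⟩
    · exact ⟨false, h⟩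
  | succ k ih =>
    rw [depthF, holds_laterF_ofRun hx hR (hsupp k)]
    simp only [ih]
    exact ⟨fun ⟨m', h1, h2⟩ => by omega, fun h => ⟨k, by omega, le_rfl⟩⟩

variable {s : ℕ → ℕ → ℕ} (hs0 : s 0 = fun _ => 0) (hrel : ∀ m, (t m).op.Rel (s m) (s (m + 1)))
include hs0 hrel

theorem holds_counterF_ofRun {i m : ℕ} {d : V} :
    (ofRun R x e t).Holds (counterF i) (x m) d ↔ e d ∈ counterElements t m i := by
  rw [counterF, holds_and, holds_neg, incF, decF, holds_laterF_ofRun hx hR (supported_var _),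
    holds_laterF_ofRun hx hR (supported_var _), mem_counterElements_iff hs0 hrel]
  simp only [holds_incF_ofRun hx, holds_decF_ofRun hx]

theorem rules_ofRun {M : List Transition} (hM : ∀ m, t m ∈ M)
    (hlink : ∀ m, (t m).tgt = (t (m + 1)).src) (u : T) (d : V) :
    (ofRun R x e t).Rules M u d := by
  have hev : ∀ p ∈ eventsOf M, ∃ i, p = 4 * i ∨ p = 4 * i + 1 := by
    intro p hp
    obtain ⟨a, -, h⟩ := List.mem_flatMap.1 hp
    exact ⟨a.op.reg, by simpa using h⟩
  have hsup : ∀ p, (ofRun R x e t).Holds (var p) u d → ∃ m, u = x m := fun p => supported_var p u d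
  refine
    { col_uniform := fun c h d' _ => ?_
      col_exclusive := fun c h h' => ?_
      exists_now := fun c h => ?_
      exists_nxt := fun c h => ?_
      nxt_once := fun h h' => ?_
      now_once := fun h h' => ?_
      exists_letter := fun h => ?_
      not_nxt_of_now := fun h h' => ?_
      not_now_of_nxt := fun h h' => ?_
      event_persist := fun p _ => persistF_ofRun hx hR (supported_var _) u d
      event_once := fun p hp h h' => ?_
      letter_persist := fun a _ => persistF_ofRun hx hR (supported_var _) u d
      now_of_letter := fun a _ h => ?_
      succession := fun a _ b _ hne h h' => ?_
      exists_event := fun a _ p _ hop h => ?_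
      no_event := fun a _ p hp hop h y _ h' => ?_
      fresh := fun a _ h h' => ?_
      added := fun a _ h => ?_
      zero_test := fun a _ i hop h y _ h' => ?_ }
  -- Each `h` concerns a propositional variable, and these are true only on the chain.
  all_goals obtain ⟨m, rfl⟩ := hsup _ h
  · rw [holds_colF_ofRun hx] at h ⊢
    exact h
  · rw [holds_colF_ofRun hx] at h h'
    cases c <;> simp at h h' <;> omega
  · exact ⟨e.symm m, Set.mem_univ _, (holds_nowF_ofRun hx).2 (by simp)⟩
  · exact ⟨e.symm (m + 1), Set.mem_univ _, (holds_nxtF_ofRun hx).2 (by simp)⟩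
  · rw [nxtF, holds_laterF_ofRun hx hR (supported_var _), ← nxtF] at h'
    obtain ⟨m', h1, h2⟩ := h'
    rw [holds_nxtF_ofRun hx] at h h2
    omega
  · rw [nowF, holds_laterF_ofRun hx hR (supported_var _), ← nowF] at h'
    obtain ⟨m', h1, h2⟩ := h'
    rw [holds_nowF_ofRun hx] at h h2
    omega
  · exact ⟨t m, hM m, (holds_letF_ofRun hx).2 ⟨rfl, (holds_nowF_ofRun hx).1 h⟩⟩
  · rw [holds_nowF_ofRun hx] at h
    rw [holds_nxtF_ofRun hx] at h'
    omega
  · obtain ⟨m', h1, h2⟩ := exists_of_dia0_ofRun hR (supported_var _) h'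
    have h3 := (holds_nowF_ofRun hx).1 h2
    have h4 := (holds_nxtF_ofRun hx).1 h
    omega
  · rw [holds_laterF_ofRun hx hR (supported_var _)] at h'
    obtain ⟨m', h1, h2⟩ := h'
    obtain ⟨i, rfl | rfl⟩ := hev p hp
    · have h3 := ((holds_incF_ofRun hx).1 h).2
      have h4 := ((holds_incF_ofRun hx).1 h2).2
      omega
    · have h3 := mem_of_removedAt hs0 hrel ((holds_decF_ofRun hx).1 h)
      exact ((mem_counterElements_iff hs0 hrel _ _ _).1 h3).2
        ⟨m', h1, (holds_decF_ofRun hx).1 h2⟩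
  · exact (holds_nowF_ofRun hx).2 ((holds_letF_ofRun hx).1 h).2
  · obtain ⟨rfl, h1⟩ := (holds_letF_ofRun hx).1 h
    obtain ⟨m', h2, h3, y, -, -, h4⟩ := exists_of_dia0_ofRun hR
      ((supported_var 11).and_left _) h'
    have h5 := (holds_nxtF_ofRun hx).1 h3
    obtain ⟨rfl, -⟩ := (holds_letF_ofRun hx).1 h4
    apply hne
    rw [hlink, show m' + 1 = m by omega]
  · obtain ⟨rfl, h1⟩ := (holds_letF_ofRun hx).1 h
    cases ho : (t m).op with
    | inc i =>
      rw [ho, CounterOp.event, Option.some.injEq] at hop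
      subst hop
      simp only [holds_incF_ofRun hx]
      refine ⟨e.symm m, Set.mem_univ _, ⟨ho, by simp⟩, fun y _ hy => ?_⟩
      rw [← hy.2, Equiv.symm_apply_apply]
    | dec i =>
      rw [ho, CounterOp.event, Option.some.injEq] at hop
      subst hop
      simp only [holds_decF_ofRun hx]
      refine ⟨e.symm (sInf (counterElements t m i : Set ℕ)), Set.mem_univ _, ⟨ho, by simp⟩,
        fun y _ hy => ?_⟩
      rw [← hy.2, Equiv.symm_apply_apply]
    | zero i => rw [ho] at hop; simp [CounterOp.event] at hop
  · obtain ⟨rfl, h1⟩ := (holds_letF_ofRun hx).1 h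
    obtain ⟨i, rfl | rfl⟩ := hev p hp
    · exact hop (by rw [((holds_incF_ofRun hx).1 h').1]; rfl)
    · exact hop (by rw [((holds_decF_ofRun hx).1 h').1]; rfl)
  · rw [decF, holds_laterF_ofRun hx hR (supported_var _)] at h'
    obtain ⟨m', h1, h2⟩ := h'
    have h3 := lt_of_mem_counterElements t (mem_of_removedAt hs0 hrel ((holds_decF_ofRun hx).1 h2))
    have h4 := ((holds_incF_ofRun hx).1 h).2
    omega
  · rw [incF, holds_laterF_ofRun hx hR (supported_var _)]
    obtain ⟨m', h1, h2⟩ := ((mem_counterElements_iff hs0 hrel _ _ _).1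
      (mem_of_removedAt hs0 hrel ((holds_decF_ofRun hx).1 h))).1
    exact ⟨m', h1, (holds_incF_ofRun hx).2 h2⟩
  · obtain ⟨rfl, h1⟩ := (holds_letF_ofRun hx).1 h
    have h2 := hrel m
    rw [hop] at h2
    have h3 := card_counterElements hs0 hrel m i
    rw [h2.1, Finset.card_eq_zero] at h3
    have h4 := (holds_counterF_ofRun hx hR hs0 hrel).1 h'
    rw [h3] at h4
    simp at h4

end

/-- An infinite run yields a model of the reduction with constant columns. -/
theorem holds_ofRun {r : T} (hx : Function.Injective x)
    (hR : ∀ n m, n ≠ m → (R (x n) (x m) ↔ m < n)) (hr : ∀ m, R r (x m))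
    {M : List Transition} {n : ℕ} (h : HasRun M n) (e : V ≃ ℕ) (d : V) :
    ∃ t, (ofRun R x e t).Holds (runF (.load :: .last :: M) n) r d := by
  obtain ⟨t, s, hM, hsrc, hs0, hlink, hrel, hload, hlast⟩ := h
  refine ⟨t, (holds_runF (Set.mem_univ d) fun _ _ => le_rfl).2 ⟨fun u _ y hy => ?_,
    fun u _ y _ => rules_ofRun hx hR hs0 hrel hM hlink u y, fun u _ y _ hn => ?_,
    x 0, hr 0, e.symm 0, Set.mem_univ _, ?_⟩⟩
  · refine (holds_inputF hy).2 ⟨fun h z _ hz => ?_, fun h => ?_⟩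
    · obtain ⟨m, rfl⟩ := supported_var _ u y h
      have h1 := hload m ((holds_letF_ofRun hx).1 h).1
      have h2 := (holds_depthF_ofRun hx hR).1 hz
      omega
    · obtain ⟨m, rfl⟩ := supported_var _ u y h
      exact ⟨y, hy, (holds_depthF_ofRun hx hR).2 (hlast m ((holds_letF_ofRun hx).1 h).1)⟩
  · obtain ⟨m, rfl⟩ := supported_var _ u y hn
    have hy := (holds_nxtF_ofRun hx).1 hn
    -- The element marked at step `m` is number `m + 1`, current at step `m + 1`.
    refine ⟨x (m + 1), hr _, Set.mem_univ _, (holds_nowF_ofRun hx).2 hy, ?_⟩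
    obtain ⟨c, hc⟩ : ∃ c, m % 2 = bif c then 0 else 1 := by
      rcases Nat.mod_two_eq_zero_or_one m with h | h
      · exact ⟨true, h⟩
      · exact ⟨false, h⟩
    refine ⟨c, holds_linkF.2 ⟨(holds_colF_ofRun hx).2 ?_, ⟨x m, (hR _ _ (by omega)).2 (by omega),
      Set.mem_univ _, (holds_colF_ofRun hx).2 hc, hn⟩, fun u hu _ h => ?_, fun u hu _ h => ?_⟩⟩
    · cases c <;> simp at hc ⊢ <;> omega
    · obtain ⟨m', rfl⟩ := supported_var _ u y h
      have h1 := (holds_nxtF_ofRun hx).1 h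
      rw [holds_colF_ofRun hx, show m' = m by omega]
      exact hc
    · obtain ⟨m', rfl⟩ := supported_var _ u y h
      have h1 := (holds_colF_ofRun hx).1 h
      have h2 := le_of_rel_ofRun hR hu
      have h3 : m' ≠ m + 1 := by
        rintro rfl
        cases c <;> simp at hc h1 <;> omega
      by_cases h4 : m' = m
      · exact Or.inl (h4 ▸ hn)
      · refine Or.inr fun h5 => ?_
        obtain ⟨m'', h6, h7⟩ := exists_of_dia0_ofRun hR (supported_var _) h5
        have h8 := (holds_nxtF_ofRun hx).1 h7
        omega
  · refine (holds_startF (Set.mem_univ _)).2 ⟨(holds_nowF_ofRun hx).2 (by simp),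
      ⟨true, (holds_colF_ofRun hx).2 rfl⟩, fun y _ h => ?_, fun a _ ha h => ?_⟩
    · obtain ⟨c, hc, u, hu, -, hcu, -⟩ := holds_laterF.1 h
      obtain ⟨m, rfl⟩ := supported_var _ u y hcu
      have h1 := le_of_rel_ofRun hR hu
      rw [holds_colF_ofRun hx] at hc hcu
      rw [show m = 0 by omega] at hcu
      cases c <;> simp at hc hcu
    · rw [← ((holds_letF_ofRun hx).1 h).1] at ha
      exact ha hsrc

end GridModel

/-! ### Transfer to the two kinds of models -/

open BiFormula

/-! ### Computability of the reduction -/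

section Computability

theorem BiFormula.primrec_toNat : Primrec BiFormula.toNat :=
  (Primrec.of_equiv (e := BiFormula.equivNat) :)

theorem BiFormula.primrec_iff {α : Type*} [Primcodable α] {f : α → BiFormula} :
    Primrec f ↔ Primrec fun a => (f a).toNat :=
  (Primrec.of_equiv_iff BiFormula.equivNat).symm

theorem BiFormula.primrec_neg : Primrec BiFormula.neg := by
  rw [primrec_iff]
  exact Primrec.nat_add.comp (Primrec.nat_mul.comp (Primrec.const 5) primrec_toNat)
    (Primrec.const 1)

theorem BiFormula.primrec_dia0 : Primrec BiFormula.dia0 := by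
  rw [primrec_iff]
  exact Primrec.nat_add.comp (Primrec.nat_mul.comp (Primrec.const 5) primrec_toNat)
    (Primrec.const 3)

theorem BiFormula.primrec_dia1 : Primrec BiFormula.dia1 := by
  rw [primrec_iff]
  exact Primrec.nat_add.comp (Primrec.nat_mul.comp (Primrec.const 5) primrec_toNat)
    (Primrec.const 4)

variable {α : Type*} [Primcodable α] {f g : α → BiFormula}

theorem Primrec.biAnd (hf : Primrec f) (hg : Primrec g) :
    Primrec fun a => BiFormula.and (f a) (g a) := by
  rw [primrec_iff]
  exact Primrec.nat_add.comp (Primrec.nat_mul.comp (Primrec.const 5)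
    (Primrec₂.natPair.comp (primrec_toNat.comp hf) (primrec_toNat.comp hg))) (Primrec.const 2)

theorem Primrec.biOr (hf : Primrec f) (hg : Primrec g) :
    Primrec fun a => BiFormula.or (f a) (g a) :=
  primrec_neg.comp ((primrec_neg.comp hf).biAnd (primrec_neg.comp hg))

theorem Primrec.biImp (hf : Primrec f) (hg : Primrec g) :
    Primrec fun a => BiFormula.imp (f a) (g a) :=
  primrec_neg.comp (hf.biAnd (primrec_neg.comp hg))

theorem Primrec.biBox0 (hf : Primrec f) : Primrec fun a => BiFormula.box0 (f a) :=
  primrec_neg.comp (primrec_dia0.comp (primrec_neg.comp hf))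

theorem Primrec.biAll (hf : Primrec f) : Primrec fun a => BiFormula.all (f a) :=
  hf.biAnd (primrec_neg.comp (primrec_dia1.comp (primrec_neg.comp hf)))

theorem Primrec.biEx (hf : Primrec f) : Primrec fun a => BiFormula.ex (f a) :=
  hf.biOr (primrec_dia1.comp hf)

theorem BiFormula.primrec_viaF (c : Bool) : Primrec (viaF c) :=
  primrec_dia0.comp ((Primrec.const _).biAnd (Primrec.id.biOr primrec_dia0))

theorem BiFormula.primrec_laterF : Primrec laterF :=
  ((Primrec.const _).biAnd (primrec_viaF false)).biOr
    ((Primrec.const _).biAnd (primrec_viaF true))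

theorem BiFormula.primrec_depthF : Primrec depthF :=
  (Primrec.nat_rec₁ tickF (primrec_laterF.comp Primrec.snd).to₂).of_eq fun n => by
    induction n with
    | zero => rfl
    | succ n ih => rw [depthF, ← ih]

/-- Only `inputF` depends on the input, through `depthF`; the rest is a fixed formula. -/
theorem BiFormula.primrec_runF (M : List Transition) : Primrec (runF M) :=
  (((((Primrec.const _).biImp (primrec_neg.comp primrec_depthF).biAll).biAnd
    ((Primrec.const _).biImp primrec_depthF.biEx)).biBox0.biAll)).biAnd (Primrec.const _)

theorem FOLTLFormula.computable_ofBi : Computable FOLTLFormula.ofBi :=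
  (Primrec.of_equiv_symm (e := FOLTLFormula.equivBi)).to_comp

end Computability

/-! ### Grid models, 2-frames and temporal models -/

section Transfer

/-- A model on a decreasing 2-frame, as a grid model. -/
def GridModel.ofTwoDim (F : KripkeFrame.{u}) {V : Type v} (G : F.W → FrameIn V)
    (ν : ℕ → Set (twoDimFrame F G).W) : GridModel F.W V where
  R := F.R
  D x := (G x).carrier
  val p x d := ∃ h : d ∈ (G x).carrier, (⟨(x, d), h⟩ : (twoDimFrame F G).W) ∈ ν p

theorem GridModel.holds_ofTwoDim (F : KripkeFrame.{u}) {V : Type v} (G : F.W → FrameIn V)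
    (hG : ∀ x, (G x).toFrame ∈ diffFrames) (ν : ℕ → Set (twoDimFrame F G).W) (φ : BiFormula)
    (w : (twoDimFrame F G).W) :
    (GridModel.ofTwoDim F G ν).Holds φ w.1.1 w.1.2 ↔ (twoDimFrame F G).Truth ν w φ := by
  induction φ generalizing w with
  | var p => exact ⟨fun ⟨_, h⟩ => h, fun h => ⟨w.2, h⟩⟩
  | neg φ ih => exact not_congr (ih w)
  | and φ ψ ih1 ih2 => exact and_congr (ih1 w) (ih2 w)
  | dia0 φ ih =>
    obtain ⟨⟨x, d⟩, hd⟩ := w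
    constructor
    · rintro ⟨x', h1, h2, h3⟩
      exact ⟨⟨(x', d), h2⟩, ⟨h1, rfl⟩, (ih ⟨(x', d), h2⟩).1 h3⟩
    · rintro ⟨⟨⟨x', d'⟩, h2⟩, ⟨h1, h4⟩, h3⟩
      obtain rfl : d = d' := h4
      exact ⟨x', h1, h2, (ih ⟨(x', d), h2⟩).2 h3⟩
  | dia1 φ ih =>
    obtain ⟨⟨x, d⟩, hd⟩ := w
    constructor
    · rintro ⟨d', h1, h2, h3⟩
      refine ⟨⟨(x, d'), h1⟩, ⟨?_, rfl⟩, (ih ⟨(x, d'), h1⟩).1 h3⟩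
      exact (hG x ⟨d, hd⟩ ⟨d', h1⟩).2 fun h => h2 (congrArg Subtype.val h).symm
    · rintro ⟨⟨⟨x', d'⟩, h2⟩, ⟨h1, h4⟩, h3⟩
      obtain rfl : x = x' := h4
      refine ⟨d', h2, ?_, (ih ⟨(x, d'), h2⟩).2 h3⟩
      rintro rfl
      exact (hG x ⟨d', hd⟩ ⟨d', h2⟩).1 h1 rfl

theorem isSatisfiableIn_runF_iff {C : Set KripkeFrame.{u}} (hC : ∀ F ∈ C, F.IsWeakOrder)
    (hchain : ∃ F ∈ C, F.ContainsOmegaSuccChain) (M : List Transition) (n : ℕ) :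
    IsSatisfiableIn (decreasingProduct C diffFrames.{v}) (runF (.load :: .last :: M) n) ↔
      HasRun M n := by
  constructor
  · rintro ⟨_, ⟨F, hF, V, G, hG, hsub, rfl⟩, ν, w, hw⟩
    exact GridModel.hasRun_of_holds (G := GridModel.ofTwoDim F G ν) (hC F hF).1 (hC F hF).2
      (fun x y hxy => (hsub x y hxy).1) w.2 ((GridModel.holds_ofTwoDim F G hG ν _ w).2 hw)
  · intro h
    obtain ⟨F, hF, x, hx, hxR⟩ := hchain
    let V : Type v := ULift.{v} ℕ
    let K : FrameIn V := ⟨Set.univ, Set.univ_nonempty, fun a b => a ≠ b, fun _ _ _ => by simp⟩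
    have hK : K.toFrame ∈ diffFrames.{v} := fun a b => by
      simp only [K, FrameIn.toFrame]
      exact not_congr Subtype.ext_iff.symm
    -- The point with index ω is the root; the finite indices are the steps.
    obtain ⟨t, ht⟩ := GridModel.holds_ofRun (r := x ⊤) (x := fun m : ℕ => x m)
      (fun m m' hm => by exact_mod_cast hx hm)
      (fun n m hnm => by rw [hxR _ _ (by exact_mod_cast hnm)]; simp)
      (fun m => (hxR _ _ (ENat.top_ne_natCast m)).2 (ENat.natCast_lt_top m)) h (Equiv.ulift : V ≃ ℕ) ⟨0⟩
    refine ⟨_, ⟨F, hF, V, fun _ => K, fun _ => hK, fun _ _ _ => ⟨subset_rfl, fun a b =>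
      ⟨fun h => ⟨h, trivial, trivial⟩, fun h => h.1⟩⟩, rfl⟩,
      fun p => {w | (GridModel.ofRun F.R (fun m : ℕ => x m) Equiv.ulift t).val p w.1.1 w.1.2},
      ⟨(x ⊤, ⟨0⟩), trivial⟩, ?_⟩
    refine (GridModel.holds_ofTwoDim F (fun _ => K) (fun _ => hK) _ _ _).1 ?_
    convert ht using 1
    simp only [GridModel.ofTwoDim, GridModel.ofRun, GridModel.mk.injEq, true_and]
    refine ⟨rfl, ?_⟩
    funext p u d
    exact propext ⟨fun h => h.2, fun h => ⟨trivial, h⟩⟩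

/-- A first-order temporal model, as a grid model. -/
def FOLTLModel.toGrid {T : Type u} [LinearOrder T] {U : Type v} (M : FOLTLModel T U) :
    GridModel T U where
  R t t' := t < t'
  D := M.dom
  val p t a := ∃ h : a ∈ M.dom t, ⟨a, h⟩ ∈ M.interp t p

theorem FOLTLModel.holds_toGrid {T : Type u} [LinearOrder T] {U : Type v} (M : FOLTLModel T U)
    (φ : BiFormula) (t : T) (a : M.dom t) :
    M.toGrid.Holds φ t a ↔ M.Truth t a (FOLTLFormula.ofBi φ) := by
  induction φ generalizing t a with
  | var p => exact ⟨fun ⟨_, h⟩ => h, fun h => ⟨a.2, h⟩⟩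
  | neg φ ih => exact not_congr (ih t a)
  | and φ ψ ih1 ih2 => exact and_congr (ih1 t a) (ih2 t a)
  | dia0 φ ih =>
    constructor
    · rintro ⟨t', h1, h2, h3⟩
      exact ⟨t', h1, h2, (ih t' ⟨a, h2⟩).1 h3⟩
    · rintro ⟨t', h1, h2, h3⟩
      exact ⟨t', h1, h2, (ih t' ⟨a, h2⟩).2 h3⟩
  | dia1 φ ih =>
    constructor
    · rintro ⟨b, h1, h2, h3⟩
      exact ⟨⟨b, h1⟩, fun h => h2 (congrArg Subtype.val h), (ih t ⟨b, h1⟩).1 h3⟩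
    · rintro ⟨b, h1, h2⟩
      exact ⟨b, b.2, fun h => h1 (Subtype.ext h), (ih t b).2 h2⟩

theorem hasRun_of_foltlSatDecreasing {T : Type u} [LinearOrder T] {M : List Transition} {n : ℕ}
    (h : FOLTLSatDecreasing.{u, v} T (FOLTLFormula.ofBi (runF (.load :: .last :: M) n))) :
    HasRun M n := by
  obtain ⟨U, N, hN, t, a, h⟩ := h
  refine GridModel.hasRun_of_holds (G := N.toGrid) (fun _ _ _ => lt_trans)
    (fun x y z _ _ => ?_) (fun t t' => hN t t') a.2 ((N.holds_toGrid _ t a).2 h)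
  rcases lt_trichotomy y z with h | h | h
  exacts [Or.inr (Or.inl h), Or.inl h, Or.inr (Or.inr h)]

theorem FOLTLSatConstant.decreasing {T : Type u} [LinearOrder T] {φ : FOLTLFormula}
    (h : FOLTLSatConstant.{u, v} T φ) : FOLTLSatDecreasing.{u, v} T φ := by
  obtain ⟨U, N, hN, h⟩ := h
  exact ⟨U, N, fun t t' ht => (hN t t' ht).ge, h⟩

theorem foltlSatConstant_of_hasRun {T : Type u} [LinearOrder T] {r : T} {x : ℕ → T}
    (hx : StrictAnti x) (hr : ∀ m, r < x m) {M : List Transition} {n : ℕ} (h : HasRun M n) :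
    FOLTLSatConstant.{u, v} T (FOLTLFormula.ofBi (runF (.load :: .last :: M) n)) := by
  obtain ⟨t, ht⟩ := GridModel.holds_ofRun (R := fun a b : T => a < b) hx.injective
    (fun n m _ => hx.lt_iff_gt) hr h (Equiv.ulift : ULift.{v} ℕ ≃ ℕ) ⟨0⟩
  let N : FOLTLModel T (ULift.{v} ℕ) :=
    ⟨fun _ => Set.univ, fun _ => Set.univ_nonempty, fun u p => {d |
      (GridModel.ofRun (fun a b : T => a < b) x Equiv.ulift t).val p u d.1}⟩
  refine ⟨_, N, fun _ _ _ => rfl, r, ⟨⟨0⟩, trivial⟩, ?_⟩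
  rw [← N.holds_toGrid]
  convert ht using 1
  simp only [N, FOLTLModel.toGrid, GridModel.ofRun, GridModel.mk.injEq, true_and]
  funext p u d
  exact propext ⟨fun h => h.2, fun h => ⟨trivial, h⟩⟩

theorem ComputablePred.comp_of_computable {α β : Type*} [Primcodable α] [Primcodable β]
    {p : β → Prop} {q : α → Prop} (hp : ComputablePred p) {f : α → β} (hf : Computable f)
    (h : ∀ a, p (f a) ↔ q a) : ComputablePred q :=
  (ComputablePred.computable_of_manyOneReducible (p := fun a => p (f a)) ⟨f, hf, fun _ => Iff.rfl⟩
    hp).of_eq h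

/-- A run gives a constant domain model, which is a decreasing domain model, which gives back a run;
so the same reduction serves both problems. -/
theorem not_computablePred_foltlSat {T : Type u} [LinearOrder T] {r : T} {x : ℕ → T}
    (hx : StrictAnti x) (hr : ∀ m, r < x m) :
    (¬ ComputablePred fun φ : FOLTLFormula => FOLTLSatConstant.{u, v} T φ) ∧
    ¬ ComputablePred fun φ : FOLTLFormula => FOLTLSatDecreasing.{u, v} T φ := by
  obtain ⟨M, hM⟩ := exists_undecidable_hasRun
  have hf : Computable fun n => FOLTLFormula.ofBi (runF (.load :: .last :: M) n) :=
    FOLTLFormula.computable_ofBi.comp (primrec_runF _).to_comp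
  exact ⟨fun hc => hM (hc.comp_of_computable hf fun n =>
      ⟨fun h => hasRun_of_foltlSatDecreasing h.decreasing, foltlSatConstant_of_hasRun hx hr⟩),
    fun hc => hM (hc.comp_of_computable hf fun n =>
      ⟨hasRun_of_foltlSatDecreasing, fun h => (foltlSatConstant_of_hasRun hx hr h).decreasing⟩)⟩

theorem strictAnti_one_div_add_one (K : Type*) [Field K] [LinearOrder K] [IsStrictOrderedRing K] :
    StrictAnti fun m : ℕ => 1 / ((m : K) + 1) := fun m n h => by
  have : (m : K) < n := Nat.cast_lt.2 h
  exact one_div_lt_one_div_of_lt (by positivity) (by linarith)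

end Transfer

theorem theorem5 :
    (∀ C : Set KripkeFrame.{u},
      (∀ F ∈ C, F.IsWeakOrder) →
      (∃ F ∈ C, F.ContainsOmegaSuccChain) →
      ¬ ComputablePred (fun φ : BiFormula =>
        IsSatisfiableIn (decreasingProduct C diffFrames.{v}) φ)) ∧
    ¬ ComputablePred (fun φ : FOLTLFormula => FOLTLSatConstant.{0, v} ℚ φ) ∧
    ¬ ComputablePred (fun φ : FOLTLFormula => FOLTLSatDecreasing.{0, v} ℚ φ) ∧
    ¬ ComputablePred (fun φ : FOLTLFormula => FOLTLSatConstant.{0, v} ℝ φ) ∧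
    ¬ ComputablePred (fun φ : FOLTLFormula => FOLTLSatDecreasing.{0, v} ℝ φ) := by
  -- The steps `1 / (m + 1)` descend towards the root 0.
  have hQ := not_computablePred_foltlSat (r := (0 : ℚ)) (strictAnti_one_div_add_one ℚ)
    fun m => by positivity
  have hR := not_computablePred_foltlSat (r := (0 : ℝ)) (strictAnti_one_div_add_one ℝ)
    fun m => by positivity
  refine ⟨fun C hC hchain hc => ?_, hQ.1, hQ.2, hR.1, hR.2⟩
  obtain ⟨M, hM⟩ := exists_undecidable_hasRun
  exact hM (hc.comp_of_computable (primrec_runF _).to_comp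
    fun n => isSatisfiableIn_runF_iff hC hchain M n)
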